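/- Let $d\ge 2$, $0<s<\frac d2$ and $\frac{2d}{d+2s}<q<\frac{d}{2s}$. All functions below are real-valued except Fourier transforms, and $\mathscr F[\varphi](\xi)=(2\pi)^{-d/2}\int_{\mathbb R^d}e^{-ix\cdot\xi}\varphi(x)\,dx$, extended to tempered distributions. Let $\mathring H^s(\mathbb R^d)$ be the space of all $u\in L^{\frac{2d}{d-2s}}(\mathbb R^d)$ whose Fourier transform is a locally integrable function with $$\|u\|_{\mathring H^s}^2:=\int_{\mathbb R^d}|\xi|^{2s}|\mathscr F[u](\xi)|^2\,d\xi<\infty,$$ and let $\mathring H^{-s}(\mathbb R^d)$ be its dual space with the dual norm. For $0<\alpha<d$ let $$I_\alpha(x)=A_\alpha|x|^{\alpha-d},\qquad A_\alpha=\frac{\Gamma((d-\alpha)/2)}{\pi^{d/2}\,2^\alpha\,\Gamma(\alpha/2)} .$$ Let $T\in\mathring H^{-s}(\mathbb R^d)\cap L^q(\mathbb R^d)$, that is, $T\in L^q(\mathbb R^d)$ and $T$ is identified with a continuous linear functional on $\mathring H^s(\mathbb R^d)$ satisfying $\langle T,\varphi\rangle=\int_{\mathbb R^d}T(x)\varphi(x)\,dx$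 for all $\varphi\in C_c^\infty(\mathbb R^d)$. Suppose that there is $f\in L^1(\mathbb R^d)$ with $T\cdot(I_{2s}*T)\ge-|f|$ almost everywhere. Then the integral defining $(I_{2s}*T)(x)$ converges absolutely for almost every $x$, the function $(I_{2s}*T)\,T$ belongs to $L^1(\mathbb R^d)$, and $$\|T\|^2_{\mathring H^{-s}(\mathbb R^d)}=\mathcal D_{2s}(T,T):=\int_{\mathbb R^d}(I_{2s}*T)(x)\,T(x)\,dx .$$ -/

import Mathlib

open MeasureTheory SchwartzMap
open scoped ENNReal ContDiff Convolution

/-- The Fourier transform in the unitary normalization,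
`F[φ](ξ) = (2π)^(-d/2) ∫ exp(-i x·ξ) φ(x) dx`. -/
noncomputable def unitaryFourier {d : ℕ} (φ : EuclideanSpace ℝ (Fin d) → ℂ)
    (ξ : EuclideanSpace ℝ (Fin d)) : ℂ :=
  (((2 * Real.pi) ^ (-(d : ℝ) / 2) : ℝ) : ℂ) *
    ∫ x, Complex.exp (-((inner ℝ x ξ : ℝ) : ℂ) * Complex.I) * φ x

/-- The Fourier transform, in the sense of tempered distributions, of the function `u` is the
locally integrable function `g`: `⟨g, φ⟩ = ⟨u, F[φ]⟩` for all Schwartz functions `φ`, where both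
pairings are absolutely convergent integrals. -/
def HasFourierTransform {d : ℕ} (u : EuclideanSpace ℝ (Fin d) → ℝ)
    (g : EuclideanSpace ℝ (Fin d) → ℂ) : Prop :=
  LocallyIntegrable g volume ∧
    ∀ φ : 𝓢(EuclideanSpace ℝ (Fin d), ℂ),
      Integrable (fun ξ => g ξ * φ ξ) volume ∧
      Integrable (fun x => (u x : ℂ) * unitaryFourier φ x) volume ∧
      ∫ ξ, g ξ * φ ξ = ∫ x, (u x : ℂ) * unitaryFourier φ x

theorem HasFourierTransform.congr {d : ℕ} {u v : EuclideanSpace ℝ (Fin d) → ℝ}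
    {g : EuclideanSpace ℝ (Fin d) → ℂ} (h : HasFourierTransform u g)
    (huv : u =ᵐ[volume] v) : HasFourierTransform v g := by
  refine ⟨h.1, fun φ => ?_⟩
  obtain ⟨h1, h2, h3⟩ := h.2 φ
  have e : (fun x => (u x : ℂ) * unitaryFourier φ x) =ᵐ[volume]
      fun x => (v x : ℂ) * unitaryFourier φ x := by
    filter_upwards [huv] with x hx
    rw [hx]
  exact ⟨h1, h2.congr e, h3.trans (integral_congr_ae e)⟩

theorem HasFourierTransform.add {d : ℕ} {u v : EuclideanSpace ℝ (Fin d) → ℝ}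
    {g h : EuclideanSpace ℝ (Fin d) → ℂ} (hu : HasFourierTransform u g)
    (hv : HasFourierTransform v h) : HasFourierTransform (u + v) (g + h) := by
  refine ⟨hu.1.add hv.1, fun φ => ?_⟩
  obtain ⟨a1, a2, a3⟩ := hu.2 φ
  obtain ⟨b1, b2, b3⟩ := hv.2 φ
  simp only [Pi.add_apply, Complex.ofReal_add, add_mul]
  exact ⟨a1.add b1, a2.add b2, by rw [integral_add a1 b1, integral_add a2 b2, a3, b3]⟩

theorem HasFourierTransform.smul {d : ℕ} {u : EuclideanSpace ℝ (Fin d) → ℝ}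
    {g : EuclideanSpace ℝ (Fin d) → ℂ} (c : ℝ) (hu : HasFourierTransform u g) :
    HasFourierTransform (c • u) (c • g) := by
  refine ⟨hu.1.smul c, fun φ => ?_⟩
  obtain ⟨a1, a2, a3⟩ := hu.2 φ
  simp only [Pi.smul_apply, smul_eq_mul, Complex.ofReal_mul, Complex.real_smul, mul_assoc]
  exact ⟨a1.const_mul _, a2.const_mul _, by rw [integral_const_mul, integral_const_mul, a3]⟩

theorem HasFourierTransform.zero {d : ℕ} :
    HasFourierTransform (0 : EuclideanSpace ℝ (Fin d) → ℝ) 0 :=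
  ⟨locallyIntegrable_zero, fun φ => by simp⟩

theorem HasFourierTransform.ae_unique {d : ℕ} {u : EuclideanSpace ℝ (Fin d) → ℝ}
    {g h : EuclideanSpace ℝ (Fin d) → ℂ} (hg : HasFourierTransform u g)
    (hh : HasFourierTransform u h) : g =ᵐ[volume] h := by
  have key : ∀ᵐ x ∂(volume : Measure (EuclideanSpace ℝ (Fin d))), (g - h) x = 0 := by
    apply ae_eq_zero_of_integral_contDiff_smul_eq_zero (hg.1.sub hh.1)
    intro w w_smooth w_cpt
    have hw₁ : HasCompactSupport (Complex.ofRealCLM ∘ w) := w_cpt.comp_left rfl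
    have hw₂ : ContDiff ℝ ∞ (Complex.ofRealCLM ∘ w) := by fun_prop
    obtain ⟨a1, a2, a3⟩ := hg.2 (hw₁.toSchwartzMap hw₂)
    obtain ⟨b1, b2, b3⟩ := hh.2 (hw₁.toSchwartzMap hw₂)
    have := integral_sub a1 b1
    rw [a3, b3, sub_self] at this
    rw [← this]
    refine integral_congr_ae (Filter.Eventually.of_forall fun x => ?_)
    simp
    ring
  filter_upwards [key] with x hx
  exact sub_eq_zero.mp hx

/-- The space of real functions `u ∈ L^{2d/(d-2s)}(ℝᵈ)` whose Fourier transform `F[u]` is a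
locally integrable function with `∫ |ξ|^{2s} |F[u](ξ)|² dξ < ∞`. -/
noncomputable def homSobolevSubmodule (d : ℕ) (s : ℝ) :
    Submodule ℝ (Lp ℝ (ENNReal.ofReal (2 * d / (d - 2 * s)))
      (volume : Measure (EuclideanSpace ℝ (Fin d)))) where
  carrier := {u | ∃ g : EuclideanSpace ℝ (Fin d) → ℂ,
    HasFourierTransform u g ∧ MemLp (fun ξ => ‖ξ‖ ^ s • g ξ) 2 volume}
  add_mem' := by
    rintro u v ⟨g, hg, hg'⟩ ⟨h, hh, hh'⟩
    refine ⟨g + h, (hg.add hh).congr (Lp.coeFn_add u v).symm, ?_⟩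
    have e : (fun ξ => ‖ξ‖ ^ s • (g + h) ξ) = (fun ξ => ‖ξ‖ ^ s • g ξ) + fun ξ => ‖ξ‖ ^ s • h ξ := by
      ext ξ
      simp
    rw [e]
    exact hg'.add hh'
  zero_mem' := ⟨0, HasFourierTransform.zero.congr (Lp.coeFn_zero _ _ _).symm, by simp⟩
  smul_mem' := by
    rintro c u ⟨g, hg, hg'⟩
    refine ⟨c • g, (hg.smul c).congr (Lp.coeFn_smul c u).symm, ?_⟩
    have e : (fun ξ => ‖ξ‖ ^ s • (c • g) ξ) = c • fun ξ => ‖ξ‖ ^ s • g ξ := by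
      ext ξ
      simp only [Pi.smul_apply]
      rw [smul_comm]
    rw [e]
    exact hg'.const_smul c

/-- The homogeneous fractional Sobolev space `H̊^s(ℝᵈ)`. It is a type of its own because its norm
is not the one of `L^{2d/(d-2s)}`. -/
def HomSobolev (d : ℕ) (s : ℝ) : Type := ↥(homSobolevSubmodule d s)

namespace HomSobolev

noncomputable instance (d : ℕ) (s : ℝ) : AddCommGroup (HomSobolev d s) :=
  inferInstanceAs (AddCommGroup ↥(homSobolevSubmodule d s))

noncomputable instance (d : ℕ) (s : ℝ) : Module ℝ (HomSobolev d s) :=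
  inferInstanceAs (Module ℝ ↥(homSobolevSubmodule d s))

/-- The element of `L^{2d/(d-2s)}(ℝᵈ)` underlying an element of `H̊^s(ℝᵈ)`. -/
noncomputable def toLp {d : ℕ} {s : ℝ} (u : HomSobolev d s) :
    Lp ℝ (ENNReal.ofReal (2 * d / (d - 2 * s))) (volume : Measure (EuclideanSpace ℝ (Fin d))) :=
  Subtype.val u

/-- The Fourier transform `F[u]` of `u ∈ H̊^s(ℝᵈ)`, a function unique up to null sets. -/
noncomputable def fourier {d : ℕ} {s : ℝ} (u : HomSobolev d s) : EuclideanSpace ℝ (Fin d) → ℂ :=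
  (Subtype.property u).choose

theorem hasFourierTransform_fourier {d : ℕ} {s : ℝ} (u : HomSobolev d s) :
    HasFourierTransform u.toLp u.fourier :=
  (Subtype.property u).choose_spec.1

theorem memLp_fourier {d : ℕ} {s : ℝ} (u : HomSobolev d s) :
    MemLp (fun ξ => ‖ξ‖ ^ s • u.fourier ξ) 2 volume :=
  (Subtype.property u).choose_spec.2

/-- The linear map `u ↦ |ξ|^s F[u](ξ)` from `H̊^s(ℝᵈ)` to `L²(ℝᵈ; ℂ)`. -/
noncomputable def toL2 (d : ℕ) (s : ℝ) :
    HomSobolev d s →ₗ[ℝ] Lp ℂ 2 (volume : Measure (EuclideanSpace ℝ (Fin d))) where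
  toFun u := u.memLp_fourier.toLp _
  map_add' u v := by
    rw [← MemLp.toLp_add]
    apply MemLp.toLp_congr
    have h := (u + v).hasFourierTransform_fourier.ae_unique
      ((u.hasFourierTransform_fourier.add v.hasFourierTransform_fourier).congr
        (Lp.coeFn_add u.toLp v.toLp).symm)
    filter_upwards [h] with ξ hξ
    simp [hξ]
  map_smul' c u := by
    rw [RingHom.id_apply, ← MemLp.toLp_const_smul]
    apply MemLp.toLp_congr
    have h := (c • u).hasFourierTransform_fourier.ae_unique
      ((u.hasFourierTransform_fourier.smul c).congr (Lp.coeFn_smul c u.toLp).symm)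
    filter_upwards [h] with ξ hξ
    simp only [hξ, Pi.smul_apply]
    rw [smul_comm]

/-- The norm of `H̊^s(ℝᵈ)`, that is, `‖u‖ = ‖|ξ|^s F[u]‖_{L²}`; see `norm_eq`.
It is definite by `eq_zero_of_norm`. -/
noncomputable instance (d : ℕ) (s : ℝ) : SeminormedAddCommGroup (HomSobolev d s) :=
  SeminormedAddCommGroup.induced (HomSobolev d s)
    (Lp ℂ 2 (volume : Measure (EuclideanSpace ℝ (Fin d)))) (toL2 d s)

noncomputable instance (d : ℕ) (s : ℝ) : NormedSpace ℝ (HomSobolev d s) :=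
  NormedSpace.induced ℝ (HomSobolev d s)
    (Lp ℂ 2 (volume : Measure (EuclideanSpace ℝ (Fin d)))) (toL2 d s)

/-- `‖u‖ = (∫ |ξ|^{2s} |F[u](ξ)|² dξ)^{1/2}`. -/
theorem norm_eq {d : ℕ} {s : ℝ} (u : HomSobolev d s) :
    ‖u‖ = Real.sqrt (∫ ξ, ‖ξ‖ ^ (2 * s) * ‖u.fourier ξ‖ ^ 2) := by
  have h : ‖u‖ = ‖u.memLp_fourier.toLp _‖ := rfl
  rw [h, Lp.norm_toLp, u.memLp_fourier.eLpNorm_eq_integral_rpow_norm (by simp) (by simp),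
    ENNReal.toReal_ofReal (by positivity), Real.sqrt_eq_rpow]
  simp only [ENNReal.toReal_ofNat, one_div]
  congr 2
  ext ξ
  rw [norm_smul, Real.norm_of_nonneg (by positivity), Real.mul_rpow (by positivity) (by positivity),
    ← Real.rpow_mul (norm_nonneg _), mul_comm s 2]
  norm_num

/-- The continuous functional `T` on `H̊^s(ℝᵈ)` is the regular distribution given by the function
`τ`: `⟨T, φ⟩ = ∫ τ φ` for all `φ ∈ C_c^∞(ℝᵈ)`. The variable `u` is `φ` as an element of
`H̊^s(ℝᵈ)`; it exists by `exists_of_test`. -/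
def IsRegularDistribution {d : ℕ} {s : ℝ} (T : StrongDual ℝ (HomSobolev d s))
    (τ : EuclideanSpace ℝ (Fin d) → ℝ) : Prop :=
  ∀ φ : EuclideanSpace ℝ (Fin d) → ℝ, ContDiff ℝ ∞ φ → HasCompactSupport φ →
    ∀ u : HomSobolev d s, u.toLp =ᵐ[volume] φ → T u = ∫ x, τ x * φ x

end HomSobolev

/-- The Riesz kernel `I_α(x) = A_α |x|^{α-d}` with
`A_α = Γ((d-α)/2) / (π^{d/2} 2^α Γ(α/2))`. -/
noncomputable def rieszKernel (d : ℕ) (α : ℝ) (x : EuclideanSpace ℝ (Fin d)) : ℝ :=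
  Real.Gamma ((d - α) / 2) / (Real.pi ^ ((d : ℝ) / 2) * 2 ^ α * Real.Gamma (α / 2)) *
    ‖x‖ ^ (α - d)

/-- The Riesz potential `I_α * τ`. -/
noncomputable def rieszPotential {d : ℕ} (α : ℝ) (τ : EuclideanSpace ℝ (Fin d) → ℝ) :
    EuclideanSpace ℝ (Fin d) → ℝ :=
  rieszKernel d α ⋆[ContinuousLinearMap.mul ℝ ℝ, volume] τ

/-- The Coulomb type energy `D_α(τ, τ) = ∫ (I_α * τ)(x) τ(x) dx`. -/
noncomputable def coulombEnergy {d : ℕ} (α : ℝ) (τ : EuclideanSpace ℝ (Fin d) → ℝ) : ℝ :=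
  ∫ x, rieszPotential α τ x * τ x

theorem unitaryFourier_eq {d : ℕ} (φ : EuclideanSpace ℝ (Fin d) → ℂ)
    (ξ : EuclideanSpace ℝ (Fin d)) :
    unitaryFourier φ ξ = (((2 * Real.pi) ^ (-(d : ℝ) / 2) : ℝ) : ℂ) *
      FourierTransform.fourier φ ((2 * Real.pi)⁻¹ • ξ) := by
  rw [unitaryFourier, Real.fourier_eq']
  congr 2
  ext x
  have h : -2 * Real.pi * inner ℝ x ((2 * Real.pi)⁻¹ • ξ) = -inner ℝ x ξ := by
    rw [inner_smul_right]
    field_simp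
  rw [h, smul_eq_mul]
  push_cast
  ring

theorem exists_schwartz_eq_unitaryFourier {d : ℕ} (φ : 𝓢(EuclideanSpace ℝ (Fin d), ℂ)) :
    ∃ G : 𝓢(EuclideanSpace ℝ (Fin d), ℂ), ∀ ξ, unitaryFourier φ ξ = G ξ := by
  let e : EuclideanSpace ℝ (Fin d) ≃L[ℝ] EuclideanSpace ℝ (Fin d) :=
    ContinuousLinearEquiv.smulLeft (Units.mk0 (2 * Real.pi)⁻¹ (by positivity))
  refine ⟨(((2 * Real.pi) ^ (-(d : ℝ) / 2) : ℝ) : ℂ) •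
    SchwartzMap.compCLMOfContinuousLinearEquiv ℂ e (FourierTransform.fourier φ), fun ξ => ?_⟩
  rw [unitaryFourier_eq]
  rfl

theorem integral_unitaryFourier_mul {d : ℕ} (φ ψ : 𝓢(EuclideanSpace ℝ (Fin d), ℂ)) :
    ∫ ξ, unitaryFourier ψ ξ * φ ξ = ∫ x, ψ x * unitaryFourier φ x := by
  have key := VectorFourier.integral_fourierIntegral_smul_eq_flip
    (μ := (volume : Measure (EuclideanSpace ℝ (Fin d)))) (ν := volume)
    (e := Real.fourierChar)
    (L := (2 * Real.pi)⁻¹ • innerₗ (EuclideanSpace ℝ (Fin d))) (f := ψ) (g := φ)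
    Real.continuous_fourierChar
    (by
      simp only [LinearMap.smul_apply, innerₗ_apply_apply]
      fun_prop) ψ.integrable φ.integrable
  have e1 : ∀ (η : 𝓢(EuclideanSpace ℝ (Fin d), ℂ)) (ξ : EuclideanSpace ℝ (Fin d)),
      unitaryFourier η ξ = (((2 * Real.pi) ^ (-(d : ℝ) / 2) : ℝ) : ℂ) *
      VectorFourier.fourierIntegral Real.fourierChar volume
        ((2 * Real.pi)⁻¹ • innerₗ (EuclideanSpace ℝ (Fin d))) η ξ := by
    intro η ξ
    rw [unitaryFourier_eq, Real.fourier_eq]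
    simp only [VectorFourier.fourierIntegral, LinearMap.smul_apply, innerₗ_apply_apply,
      inner_smul_right, smul_eq_mul]
  have e2 : ((2 * Real.pi)⁻¹ • innerₗ (EuclideanSpace ℝ (Fin d))).flip =
      (2 * Real.pi)⁻¹ • innerₗ (EuclideanSpace ℝ (Fin d)) := by
    ext x y
    simp [real_inner_comm]
  rw [e2] at key
  simp only [smul_eq_mul] at key
  simp only [e1, mul_assoc, mul_left_comm (ψ _), integral_const_mul]
  rw [key]

theorem hasFourierTransform_of_schwartz {d : ℕ} (u : EuclideanSpace ℝ (Fin d) → ℝ)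
    (ψ : 𝓢(EuclideanSpace ℝ (Fin d), ℂ)) (h : ∀ x, ψ x = u x) :
    HasFourierTransform u (unitaryFourier ψ) := by
  obtain ⟨G, hG⟩ := exists_schwartz_eq_unitaryFourier ψ
  have hG' : unitaryFourier ψ = G := funext hG
  have hint : ∀ a b : 𝓢(EuclideanSpace ℝ (Fin d), ℂ), Integrable (fun x => a x * b x) volume :=
    fun a b => (a.memLp 2).integrable_mul (b.memLp 2)
  refine ⟨?_, fun φ => ?_⟩
  · rw [hG']
    exact G.integrable.locallyIntegrable
  · obtain ⟨H, hH⟩ := exists_schwartz_eq_unitaryFourier φ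
    refine ⟨?_, ?_, ?_⟩
    · rw [hG']
      exact hint G φ
    · simp only [← h, hH]
      exact hint ψ H
    · simp only [← h]
      exact integral_unitaryFourier_mul φ ψ

/-- Test functions belong to `H̊^s(ℝᵈ)`. -/
theorem HomSobolev.exists_of_test {d : ℕ} {s : ℝ} (hs : 0 ≤ s)
    (φ : EuclideanSpace ℝ (Fin d) → ℝ) (h1 : ContDiff ℝ ∞ φ) (h2 : HasCompactSupport φ) :
    ∃ u : HomSobolev d s, u.toLp =ᵐ[volume] φ := by
  have hw₁ : HasCompactSupport (Complex.ofRealCLM ∘ φ) := h2.comp_left rfl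
  have hw₂ : ContDiff ℝ ∞ (Complex.ofRealCLM ∘ φ) := by fun_prop
  have hL : MemLp φ (ENNReal.ofReal (2 * d / (d - 2 * s))) volume :=
    h1.continuous.memLp_of_hasCompactSupport h2
  have hF := hasFourierTransform_of_schwartz φ (hw₁.toSchwartzMap hw₂) (fun x => rfl)
  obtain ⟨G, hG⟩ := exists_schwartz_eq_unitaryFourier (hw₁.toSchwartzMap hw₂)
  refine ⟨⟨hL.toLp φ, _, hF.congr hL.coeFn_toLp.symm, ?_⟩, hL.coeFn_toLp⟩
  have hm : AEStronglyMeasurable (fun ξ : EuclideanSpace ℝ (Fin d) => ‖ξ‖ ^ s • G ξ) volume :=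
    ((continuous_norm.rpow_const fun _ => Or.inr hs).smul G.continuous).aestronglyMeasurable
  simp only [hG]
  obtain ⟨n, hn⟩ := exists_nat_ge s
  have hd : MemLp (fun ξ : EuclideanSpace ℝ (Fin d) => ‖G ξ‖ + ‖ξ‖ ^ n * ‖G ξ‖) 2 volume := by
    refine (G.memLp 2).norm.add ?_
    have hc : Continuous fun ξ : EuclideanSpace ℝ (Fin d) => ‖ξ‖ ^ n * ‖G ξ‖ := by fun_prop
    obtain ⟨C, hC⟩ := G.decay n 0
    have hi := G.integrable_pow_mul volume n
    rw [memLp_two_iff_integrable_sq hc.aestronglyMeasurable]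
    refine (hi.const_mul C).mono' (hc.pow 2).aestronglyMeasurable
      (Filter.Eventually.of_forall fun ξ => ?_)
    have := hC.2 ξ
    rw [norm_iteratedFDeriv_zero] at this
    rw [Real.norm_of_nonneg (by positivity), sq]
    gcongr
  refine hd.mono hm (Filter.Eventually.of_forall fun ξ => ?_)
  rw [norm_smul, Real.norm_of_nonneg (by positivity), Real.norm_of_nonneg (by positivity)]
  have : ‖ξ‖ ^ s ≤ 1 + ‖ξ‖ ^ n := by
    rcases le_total ‖ξ‖ 1 with h | h
    · exact (Real.rpow_le_one (norm_nonneg _) h hs).trans (by simp)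
    · calc ‖ξ‖ ^ s ≤ ‖ξ‖ ^ (n : ℝ) := Real.rpow_le_rpow_of_exponent_le h hn
        _ = ‖ξ‖ ^ n := Real.rpow_natCast _ _
        _ ≤ _ := by simp
  nlinarith [norm_nonneg (G ξ)]

/-- For `d ≥ 1` the seminorm of `H̊^s(ℝᵈ)` is a norm. -/
theorem HomSobolev.eq_zero_of_norm {d : ℕ} {s : ℝ} (hd : 1 ≤ d)
    (u : HomSobolev d s) (hu : ‖u‖ = 0) : u = 0 := by
  have : Nonempty (Fin d) := ⟨⟨0, hd⟩⟩
  have h0 : u.memLp_fourier.toLp _ = 0 := norm_eq_zero.mp hu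
  have h1 : u.fourier =ᵐ[volume] 0 := by
    have := (MemLp.toLp_eq_toLp_iff u.memLp_fourier (MemLp.zero)).mp
      (h0.trans (MemLp.toLp_zero _).symm)
    have hne : ∀ᵐ ξ : EuclideanSpace ℝ (Fin d), ξ ≠ 0 := by
      simp [ae_iff]
    filter_upwards [this, hne] with ξ h hξ
    have h' : ‖ξ‖ ^ s ≠ 0 := (Real.rpow_pos_of_pos (norm_pos_iff.mpr hξ) s).ne'
    have h'' : ‖ξ‖ ^ s • u.fourier ξ = 0 := h
    exact (smul_eq_zero.mp h'').resolve_left h'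
  have hz : ∀ φ : 𝓢(EuclideanSpace ℝ (Fin d), ℂ),
      Integrable (fun x => (u.toLp x : ℂ) * φ x) ∧ ∫ x, (u.toLp x : ℂ) * φ x = 0 := by
    intro φ
    let e : EuclideanSpace ℝ (Fin d) ≃L[ℝ] EuclideanSpace ℝ (Fin d) :=
      ContinuousLinearEquiv.smulLeft (Units.mk0 (2 * Real.pi) (by positivity))
    have hc : (((2 * Real.pi) ^ (-(d : ℝ) / 2) : ℝ) : ℂ) ≠ 0 := by
      exact_mod_cast (by positivity : (2 * Real.pi) ^ (-(d : ℝ) / 2) ≠ 0)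
    let ψ : 𝓢(EuclideanSpace ℝ (Fin d), ℂ) := (((2 * Real.pi) ^ (-(d : ℝ) / 2) : ℝ) : ℂ)⁻¹ •
      FourierTransform.fourierInv (SchwartzMap.compCLMOfContinuousLinearEquiv ℂ e φ)
    have hψ : ∀ x, unitaryFourier ψ x = φ x := by
      intro x
      rw [unitaryFourier_eq]
      have : FourierTransform.fourier (ψ : EuclideanSpace ℝ (Fin d) → ℂ)
          = (FourierTransform.fourier ψ : 𝓢(EuclideanSpace ℝ (Fin d), ℂ)) := rfl
      rw [this]
      simp only [ψ, FourierTransform.fourier_smul, FourierTransform.fourier_fourierInv_eq]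
      have h3 : e ((2 * Real.pi)⁻¹ • x) = x := by
        change (2 * Real.pi) • ((2 * Real.pi)⁻¹ • x) = x
        rw [smul_smul, mul_inv_cancel₀ (by positivity), one_smul]
      change _ * (_ * φ (e _)) = _
      rw [h3, mul_inv_cancel_left₀ hc]
    obtain ⟨a1, a2, a3⟩ := u.hasFourierTransform_fourier.2 ψ
    simp only [hψ] at a2 a3
    refine ⟨a2, a3 ▸ ?_⟩
    rw [integral_eq_zero_of_ae]
    filter_upwards [h1] with x hx
    simp [hx]
  have hloc : LocallyIntegrable (fun x => (u.toLp x : ℂ)) := by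
    rw [locallyIntegrable_iff]
    intro K hK
    obtain ⟨R, hR, hKR⟩ := hK.isBounded.subset_closedBall_lt 0 (0 : EuclideanSpace ℝ (Fin d))
    let χ : ContDiffBump (0 : EuclideanSpace ℝ (Fin d)) := ⟨R, R + 1, hR, by linarith⟩
    have c1 : HasCompactSupport (Complex.ofRealCLM ∘ χ) := χ.hasCompactSupport.comp_left rfl
    have c2 : ContDiff ℝ ∞ (Complex.ofRealCLM ∘ χ) := Complex.ofRealCLM.contDiff.comp χ.contDiff
    refine ((hz (c1.toSchwartzMap c2)).1.integrableOn (s := K)).congr_fun (fun x hx => ?_)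
      hK.measurableSet
    have : χ x = 1 := χ.one_of_mem_closedBall (hKR hx)
    simp [this]
  have hu0 : ∀ᵐ x ∂(volume : Measure (EuclideanSpace ℝ (Fin d))), (u.toLp x : ℂ) = 0 := by
    apply ae_eq_zero_of_integral_contDiff_smul_eq_zero hloc
    intro w w_smooth w_cpt
    have hw₁ : HasCompactSupport (Complex.ofRealCLM ∘ w) := w_cpt.comp_left rfl
    have hw₂ : ContDiff ℝ ∞ (Complex.ofRealCLM ∘ w) := by fun_prop
    rw [← (hz (hw₁.toSchwartzMap hw₂)).2]
    refine integral_congr_ae (Filter.Eventually.of_forall fun x => ?_)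
    simp [mul_comm]
  have : u.toLp = 0 := by
    apply Lp.ext
    filter_upwards [hu0, Lp.coeFn_zero ℝ (ENNReal.ofReal (2 * d / (d - 2 * s)))
      (volume : Measure (EuclideanSpace ℝ (Fin d)))] with x hx h0
    rw [h0]
    simpa using hx
  exact Subtype.ext this

/-
Write `T̂ = H |2πξ|^s` with `H ∈ L²` and `‖H‖₂ = ‖T‖`. Inserting a Gaussian cutoff `g_a` on one
factor, and expressing both `|x|^(2s-d)` and its Fourier transform `|ξ|^(-2s)` as superpositions of
Gaussians, turns `∫ g_a T (I_{2s} * T)` into the form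
`∫∫ h_a(ξ - η) |ξ|^s |η|^(-s) H(ξ) H(-η) dξ dη`, where `h_a = 𝓕 g_a` is the heat kernel. As `a → 0`
the kernel `h_a(ξ - η)` concentrates on the diagonal. Averaging `|ξ|^(-2s)` over a heat kernel costs
only a constant factor, so the weights `|ξ|^s |η|^(-s)` do no harm and the form tends to
`∫ H(ξ) H(-ξ) dξ = ∫ |H|² = ‖T‖²`. Since `g_a ↑ 1`, the lower bound `-|f|` and Fatou's lemma give
the integrability of `T (I_{2s} * T)`, after which dominated convergence identifies its integral
with the limit.
-/

open Real Set Filter Module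
open scoped Topology FourierTransform ComplexConjugate RealInnerProductSpace

section Gaussian

variable {E : Type*} [NormedAddCommGroup E]

/-- The Gaussian `exp (-π b ‖x‖²)`. -/
noncomputable def gaussianWeight (b : ℝ) (x : E) : ℝ := exp (-(π * b) * ‖x‖ ^ 2)

theorem gaussianWeight_pos (b : ℝ) (x : E) : 0 < gaussianWeight b x := exp_pos _

theorem gaussianWeight_le_one {b : ℝ} (hb : 0 ≤ b) (x : E) : gaussianWeight b x ≤ 1 :=
  exp_le_one_iff.mpr (by rw [neg_mul]; exact neg_nonpos.mpr (by positivity))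

theorem gaussianWeight_neg (b : ℝ) (x : E) : gaussianWeight b (-x) = gaussianWeight b x := by
  rw [gaussianWeight, gaussianWeight, norm_neg]

@[fun_prop]
theorem continuous_gaussianWeight {b : ℝ} : Continuous (gaussianWeight (E := E) b) := by
  unfold gaussianWeight
  fun_prop

theorem tendsto_gaussianWeight_zero (x : E) :
    Tendsto (fun b => gaussianWeight b x) (𝓝 0) (𝓝 1) := by
  have h : Continuous fun b : ℝ => gaussianWeight b x := by
    unfold gaussianWeight
    fun_prop
  simpa [gaussianWeight] using h.tendsto 0

variable [InnerProductSpace ℝ E]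

/-- The heat kernel `a^(-n/2) exp (-π ‖ξ‖² / a)`, which has total mass one and is the Fourier
transform of `gaussianWeight a`. -/
noncomputable def heatKernel (a : ℝ) (ξ : E) : ℝ :=
  a ^ (-(finrank ℝ E : ℝ) / 2) * gaussianWeight a⁻¹ ξ

theorem heatKernel_neg (a : ℝ) (ξ : E) : heatKernel a (-ξ) = heatKernel a ξ := by
  rw [heatKernel, heatKernel, gaussianWeight_neg]

theorem heatKernel_pos {a : ℝ} (ha : 0 < a) (ξ : E) : 0 < heatKernel a ξ :=
  mul_pos (rpow_pos_of_pos ha _) (gaussianWeight_pos _ _)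

theorem contDiff_gaussianWeight {b : ℝ} : ContDiff ℝ ∞ (gaussianWeight (E := E) b) :=
  (contDiff_const.mul (contDiff_norm_sq ℝ)).exp

@[fun_prop]
theorem continuous_heatKernel {a : ℝ} : Continuous (heatKernel (E := E) a) := by
  unfold heatKernel
  fun_prop

theorem heatKernel_sqrt_smul {a : ℝ} (ha : 0 < a) (w : E) :
    heatKernel a (√a • w) = a ^ (-(finrank ℝ E : ℝ) / 2) * heatKernel 1 w := by
  simp only [heatKernel, gaussianWeight, norm_smul, norm_of_nonneg (sqrt_nonneg a), mul_pow,
    sq_sqrt ha.le, one_rpow, one_mul, inv_one]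
  congr 2
  field_simp

/-- Completing the square. -/
theorem gaussianWeight_mul_heatKernel_sub {a b : ℝ} (ha : 0 < a) (hb : 0 ≤ b) (ξ η : E) :
    gaussianWeight b η * heatKernel a (ξ - η) = a ^ (-(finrank ℝ E : ℝ) / 2) *
      (gaussianWeight (b / (1 + a * b)) ξ *
        gaussianWeight (a⁻¹ * (1 + a * b)) (η - (1 + a * b)⁻¹ • ξ)) := by
  have h : (0 : ℝ) < 1 + a * b := by positivity
  rw [heatKernel, mul_left_comm]
  simp only [gaussianWeight, ← exp_add]
  congr 2
  simp only [norm_sub_sq_real, norm_smul, inner_smul_right, norm_of_nonneg (inv_nonneg.mpr h.le),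
    real_inner_comm ξ η]
  field_simp
  ring

variable [FiniteDimensional ℝ E] [MeasurableSpace E] [BorelSpace E]

theorem integral_gaussianWeight {b : ℝ} (hb : 0 < b) :
    ∫ x : E, gaussianWeight b x = b ^ (-(finrank ℝ E : ℝ) / 2) := by
  simp only [gaussianWeight]
  rw [GaussianFourier.integral_rexp_neg_mul_sq_norm (by positivity), neg_div, rpow_neg hb.le,
    ← inv_rpow hb.le]
  congr 1
  field_simp

theorem integrable_gaussianWeight {b : ℝ} (hb : 0 < b) : Integrable (gaussianWeight (E := E) b) :=
  .of_integral_ne_zero (by rw [integral_gaussianWeight hb]; positivity)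

theorem integrable_heatKernel {a : ℝ} (ha : 0 < a) : Integrable (heatKernel (E := E) a) :=
  (integrable_gaussianWeight (inv_pos.mpr ha)).const_mul _

theorem integral_heatKernel {a : ℝ} (ha : 0 < a) : ∫ ξ : E, heatKernel a ξ = 1 := by
  simp only [heatKernel]
  rw [integral_const_mul, integral_gaussianWeight (inv_pos.mpr ha), inv_rpow ha.le,
    mul_inv_cancel₀ (by positivity)]

theorem integral_gaussianWeight_mul_heatKernel_sub {a b : ℝ} (ha : 0 < a) (hb : 0 ≤ b) (ξ : E) :
    ∫ η, gaussianWeight b η * heatKernel a (ξ - η) =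
      (1 + a * b) ^ (-(finrank ℝ E : ℝ) / 2) * gaussianWeight (b / (1 + a * b)) ξ := by
  simp only [gaussianWeight_mul_heatKernel_sub ha hb]
  rw [integral_const_mul, integral_const_mul,
    integral_sub_right_eq_self (gaussianWeight (a⁻¹ * (1 + a * b))),
    integral_gaussianWeight (by positivity), mul_rpow (by positivity) (by positivity),
    inv_rpow ha.le, mul_left_comm, mul_inv_cancel_left₀ (by positivity), mul_comm]

theorem fourier_gaussianWeight {a : ℝ} (ha : 0 < a) (ξ : E) :
    𝓕 (fun x : E => (gaussianWeight a x : ℂ)) ξ = heatKernel a ξ := by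
  have h := fourier_gaussian_innerProductSpace (V := E) (b := (π * a : ℝ))
    (by simpa using by positivity) ξ
  have e : (fun x : E => (gaussianWeight a x : ℂ)) =
      fun x => Complex.exp (-((π * a : ℝ) : ℂ) * (‖x‖ : ℂ) ^ 2) := by
    ext x
    simp [gaussianWeight]
  rw [e, h, heatKernel, gaussianWeight, neg_div, rpow_neg ha.le, ← inv_rpow ha.le]
  push_cast
  rw [Complex.ofReal_cpow (by positivity)]
  have := pi_ne_zero
  congr 1
  · push_cast
    rw [← div_div, div_self (by simp), one_div]
  · congr 1
    field_simp

theorem fourier_modulated_gaussianWeight {a : ℝ} (ha : 0 < a) (η ξ : E) :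
    𝓕 (fun x : E => Complex.exp (↑(2 * π * ⟪x, η⟫) * Complex.I) * gaussianWeight a x) ξ =
      heatKernel a (ξ - η) := by
  rw [← fourier_gaussianWeight ha, Real.fourier_eq', Real.fourier_eq']
  refine integral_congr_ae (.of_forall fun x => ?_)
  simp only [smul_eq_mul, ← mul_assoc, ← Complex.exp_add, inner_sub_right]
  push_cast
  ring_nf

theorem fourier_translated_gaussianWeight {b : ℝ} (hb : 0 < b) (x ξ : E) :
    𝓕 (fun y : E => (gaussianWeight b (y - x) : ℂ)) ξ =
      Complex.exp (↑(-2 * π * ⟪x, ξ⟫) * Complex.I) * heatKernel b ξ := by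
  rw [← fourier_gaussianWeight hb, Real.fourier_eq', Real.fourier_eq', ← integral_const_mul,
    ← integral_add_right_eq_self _ x]
  refine integral_congr_ae (.of_forall fun y => ?_)
  simp only [smul_eq_mul, ← mul_assoc, ← Complex.exp_add, inner_add_left, add_sub_cancel_right]
  push_cast
  ring_nf

end Gaussian

section Subordination

theorem integrable_prod_smul {X Y V : Type*} [MeasurableSpace X] [MeasurableSpace Y]
    [NormedAddCommGroup V] [NormedSpace ℝ V] {μ : Measure X} {ν : Measure Y} [SFinite ν]
    {F : X → V} {κ : X → Y → ℝ} (hF : AEStronglyMeasurable F μ)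
    (hκ : Measurable (Function.uncurry κ)) (hκ₀ : ∀ᵐ x ∂μ, 0 ≤ᵐ[ν] κ x)
    (hκi : ∀ᵐ x ∂μ, Integrable (κ x) ν) (h : Integrable (fun x => (∫ y, κ x y ∂ν) • F x) μ) :
    Integrable (fun z : X × Y => κ z.1 z.2 • F z.1) (μ.prod ν) := by
  have hm : AEStronglyMeasurable (fun z : X × Y => κ z.1 z.2 • F z.1) (μ.prod ν) :=
    hκ.aestronglyMeasurable.smul hF.comp_fst
  refine (integrable_prod_iff hm).mpr ⟨hκi.mono fun x hx => hx.smul_const (F x), h.norm.congr ?_⟩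
  filter_upwards [hκ₀] with x hx
  simp only [norm_smul]
  rw [integral_mul_const, norm_of_nonneg (integral_nonneg_of_ae hx)]
  congr 1
  exact integral_congr_ae (hx.mono fun y hy => (norm_of_nonneg hy).symm)

theorem integral_integral_smul {X Y V : Type*} [MeasurableSpace X] [MeasurableSpace Y]
    [NormedAddCommGroup V] [NormedSpace ℝ V] [CompleteSpace V] {μ : Measure X} {ν : Measure Y}
    [SFinite μ] [SFinite ν] {F : X → V} {κ : X → Y → ℝ} (hF : AEStronglyMeasurable F μ)
    (hκ : Measurable (Function.uncurry κ)) (hκ₀ : ∀ᵐ x ∂μ, 0 ≤ᵐ[ν] κ x)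
    (hκi : ∀ᵐ x ∂μ, Integrable (κ x) ν) (h : Integrable (fun x => (∫ y, κ x y ∂ν) • F x) μ) :
    ∫ y, ∫ x, κ x y • F x ∂μ ∂ν = ∫ x, (∫ y, κ x y ∂ν) • F x ∂μ := by
  rw [← integral_integral_swap (integrable_prod_smul hF hκ hκ₀ hκi h)]
  simp only [integral_smul_const]

theorem integral_integral_integral_smul {X X' Y V : Type*} [MeasurableSpace X] [MeasurableSpace X']
    [MeasurableSpace Y] [NormedAddCommGroup V] [NormedSpace ℝ V] [CompleteSpace V]
    {μ : Measure X} {μ' : Measure X'} {ν : Measure Y} [SFinite μ] [SFinite μ'] [SFinite ν]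
    {F : X × X' → V} {κ : X × X' → Y → ℝ} (hF : AEStronglyMeasurable F (μ.prod μ'))
    (hκ : Measurable (Function.uncurry κ)) (hκ₀ : ∀ᵐ z ∂μ.prod μ', 0 ≤ᵐ[ν] κ z)
    (hκi : ∀ᵐ z ∂μ.prod μ', Integrable (κ z) ν)
    (h : Integrable (fun z => (∫ y, κ z y ∂ν) • F z) (μ.prod μ')) :
    ∫ y, ∫ x, ∫ x', κ (x, x') y • F (x, x') ∂μ' ∂μ ∂ν =
      ∫ z, (∫ y, κ z y ∂ν) • F z ∂μ.prod μ' := by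
  rw [← integral_integral_smul hF hκ hκ₀ hκi h]
  refine integral_congr_ae ?_
  filter_upwards [(integrable_prod_smul hF hκ hκ₀ hκi h).prod_left_ae] with y hy
  exact (integral_prod _ hy).symm

variable {E : Type*} [NormedAddCommGroup E]

theorem integral_rpow_mul_gaussianWeight {p : ℝ} (hp : 0 < p) {x : E} (hx : x ≠ 0) :
    ∫ b in Ioi (0 : ℝ), b ^ (p - 1) * gaussianWeight b x =
      π ^ (-p) * Gamma p * ‖x‖ ^ (-(2 * p)) := by
  have h := integral_rpow_mul_exp_neg_mul_Ioi hp (r := π * ‖x‖ ^ 2) (by positivity)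
  have e : ∀ b, gaussianWeight b x = exp (-(π * ‖x‖ ^ 2 * b)) := fun b => by
    rw [gaussianWeight]
    ring_nf
  simp only [e, h]
  rw [one_div, inv_rpow (by positivity), ← rpow_neg (by positivity),
    mul_rpow pi_pos.le (by positivity), ← rpow_natCast, ← rpow_mul (norm_nonneg x)]
  push_cast
  ring_nf

theorem integrableOn_rpow_mul_gaussianWeight {p : ℝ} (hp : 0 < p) {x : E} (hx : x ≠ 0) :
    IntegrableOn (fun b => b ^ (p - 1) * gaussianWeight b x) (Ioi 0) :=
  .of_integral_ne_zero (by
    rw [integral_rpow_mul_gaussianWeight hp hx]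
    have := Gamma_pos_of_pos hp
    positivity)

variable [InnerProductSpace ℝ E]

theorem integral_rpow_mul_heatKernel {α : ℝ} (hα : 0 < α) {ξ : E} (hξ : ξ ≠ 0) :
    ∫ b in Ioi (0 : ℝ), b ^ ((finrank ℝ E - α) / 2 - 1) * heatKernel b ξ =
      π ^ (-(α / 2)) * Gamma (α / 2) * ‖ξ‖ ^ (-α) := by
  have h := integral_rpow_mul_gaussianWeight (half_pos hα) hξ
  rw [← integral_comp_rpow_Ioi _ (show (-1 : ℝ) ≠ 0 by norm_num)] at h
  rw [show -α = -(2 * (α / 2)) by ring, ← h]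
  refine setIntegral_congr_fun measurableSet_Ioi fun b (hb : 0 < b) => ?_
  simp only [heatKernel, abs_neg, abs_one, one_mul, smul_eq_mul, rpow_neg_one, ← mul_assoc,
    inv_rpow hb.le, ← rpow_neg hb.le, ← rpow_add hb]
  ring_nf

theorem integrableOn_rpow_mul_heatKernel {α : ℝ} (hα : 0 < α) {ξ : E} (hξ : ξ ≠ 0) :
    IntegrableOn (fun b => b ^ ((finrank ℝ E - α) / 2 - 1) * heatKernel b ξ) (Ioi 0) :=
  .of_integral_ne_zero (by
    rw [integral_rpow_mul_heatKernel hα hξ]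
    have := Gamma_pos_of_pos (half_pos hα)
    positivity)

end Subordination

section HeatAverage

theorem exp_neg_le_rpow {m y : ℝ} (hm : 0 < m) (hy : 0 < y) : exp (-y) ≤ m ^ m * y ^ (-m) := by
  have h : (y / m) ^ m ≤ exp y := calc
    (y / m) ^ m ≤ exp (y / m) ^ m := by
      gcongr
      linarith [add_one_le_exp (y / m)]
    _ = exp y := by rw [← exp_mul, div_mul_cancel₀ y hm.ne']
  rw [exp_neg, rpow_neg hy.le, ← div_eq_mul_inv, ← inv_div, ← div_rpow hy.le hm.le]
  exact inv_anti₀ (by positivity) h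

/-- The function `min 1 ((m / (π t))^m)`, which dominates `exp (-π t)` and its regularizations
`(1 + x)^(-m) exp (-π t / (1 + x))` for `x ≥ 0`. -/
noncomputable def gaussianMajorant (m t : ℝ) : ℝ := min 1 ((m / π) ^ m * t ^ (-m))

theorem gaussianMajorant_nonneg {m t : ℝ} (hm : 0 ≤ m) (ht : 0 < t) : 0 ≤ gaussianMajorant m t :=
  le_min zero_le_one (by positivity)

theorem integrableOn_rpow_mul_gaussianMajorant_Ioi {p m : ℝ} (hp : 0 < p) (hpm : p < m) :
    IntegrableOn (fun b => b ^ (p - 1) * gaussianMajorant m b) (Ioi 0) := by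
  have hm : 0 < m := hp.trans hpm
  have hmeas : Measurable fun b : ℝ => b ^ (p - 1) * gaussianMajorant m b := by
    unfold gaussianMajorant
    fun_prop
  have hnorm : ∀ b : ℝ, 0 < b → ‖b ^ (p - 1) * gaussianMajorant m b‖ =
      b ^ (p - 1) * gaussianMajorant m b := fun b hb =>
    norm_of_nonneg (mul_nonneg (by positivity) (gaussianMajorant_nonneg hm.le hb))
  rw [← Ioc_union_Ioi_eq_Ioi zero_le_one]
  refine IntegrableOn.union ?_ ?_
  · have h : IntegrableOn (fun b : ℝ => b ^ (p - 1)) (Ioc 0 1) :=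
      (intervalIntegral.intervalIntegrable_rpow' (by linarith)).1
    refine h.mono' hmeas.aestronglyMeasurable ?_
    refine (ae_restrict_mem measurableSet_Ioc).mono fun b hb => ?_
    have hb₀ : 0 < b := hb.1
    rw [hnorm b hb₀]
    exact mul_le_of_le_one_right (by positivity) (min_le_left _ _)
  · have h : IntegrableOn (fun b : ℝ => (m / π) ^ m * b ^ (p - 1 - m)) (Ioi 1) :=
      (integrableOn_Ioi_rpow_of_lt (by linarith) zero_lt_one).const_mul _
    refine h.mono' hmeas.aestronglyMeasurable ?_
    refine (ae_restrict_mem measurableSet_Ioi).mono fun b (hb : 1 < b) => ?_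
    have hb₀ : 0 < b := one_pos.trans hb
    rw [hnorm b hb₀, sub_eq_add_neg _ m, rpow_add hb₀, mul_left_comm]
    gcongr
    exact min_le_right _ _

theorem integral_rpow_mul_comp_mul {p u : ℝ} (hu : 0 < u) (G : ℝ → ℝ) :
    ∫ b in Ioi 0, b ^ (p - 1) * G (u * b) = u ^ (-p) * ∫ b in Ioi 0, b ^ (p - 1) * G b := by
  have h := integral_comp_mul_left_Ioi (fun b => b ^ (p - 1) * G b) 0 hu
  rw [mul_zero, smul_eq_mul] at h
  rw [show -p = -(p - 1) + -1 by ring, rpow_add hu, rpow_neg_one, mul_assoc, ← h,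
    ← integral_const_mul]
  refine setIntegral_congr_fun measurableSet_Ioi fun b (hb : 0 < b) => ?_
  simp only [mul_rpow hu.le hb.le, ← mul_assoc, ← rpow_add hu]
  simp

theorem integrableOn_rpow_mul_comp_mul {p u : ℝ} (hu : 0 < u) {G : ℝ → ℝ}
    (hG : IntegrableOn (fun b => b ^ (p - 1) * G b) (Ioi 0)) :
    IntegrableOn (fun b => b ^ (p - 1) * G (u * b)) (Ioi 0) := by
  have h : IntegrableOn (fun b => (u * b) ^ (p - 1) * G (u * b)) (Ioi 0) :=
    (integrableOn_Ioi_comp_mul_left_iff (fun b => b ^ (p - 1) * G b) 0 hu).mpr (by rwa [mul_zero])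
  refine IntegrableOn.congr_fun (h.const_mul (u ^ (-(p - 1)))) (fun b (hb : 0 < b) => ?_)
    measurableSet_Ioi
  simp only [mul_rpow hu.le hb.le, ← mul_assoc, ← rpow_add hu]
  simp

variable {E : Type*} [NormedAddCommGroup E]

theorem rpow_mul_gaussianWeight_le {m : ℝ} (hm : 0 < m) {a b : ℝ} (ha : 0 ≤ a) (hb : 0 < b)
    {ξ : E} (hξ : ξ ≠ 0) :
    (1 + a * b) ^ (-m) * gaussianWeight (b / (1 + a * b)) ξ ≤
      gaussianMajorant m (‖ξ‖ ^ 2 * b) := by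
  have hab : 1 ≤ 1 + a * b := by linarith [mul_nonneg ha hb.le]
  have hab₀ : 0 < 1 + a * b := one_pos.trans_le hab
  refine le_min (mul_le_one₀ (rpow_le_one_of_one_le_of_nonpos hab (by linarith))
    (gaussianWeight_pos _ _).le (gaussianWeight_le_one (by positivity) _)) ?_
  set y : ℝ := π * (‖ξ‖ ^ 2 * b) / (1 + a * b) with hy
  have hξ' : 0 < ‖ξ‖ := norm_pos_iff.mpr hξ
  have hGy : gaussianWeight (b / (1 + a * b)) ξ = exp (-y) := by
    rw [gaussianWeight, hy]
    congr 1
    ring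
  calc (1 + a * b) ^ (-m) * gaussianWeight (b / (1 + a * b)) ξ
      ≤ (1 + a * b) ^ (-m) * (m ^ m * y ^ (-m)) := by
        rw [hGy]
        gcongr
        exact exp_neg_le_rpow hm (by positivity)
    _ = (m / π) ^ m * (‖ξ‖ ^ 2 * b) ^ (-m) := by
        rw [mul_left_comm, ← mul_rpow (by positivity) (by positivity), hy,
          mul_div_cancel₀ _ hab₀.ne', mul_rpow pi_pos.le (by positivity), div_rpow hm.le pi_pos.le,
          rpow_neg pi_pos.le, div_eq_mul_inv, mul_assoc]

variable [InnerProductSpace ℝ E] {β a : ℝ} {ξ : E}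

theorem norm_rpow_mul_gaussianWeight_div_le {p b : ℝ} (hn : 0 < (finrank ℝ E : ℝ)) (ha : 0 ≤ a)
    (hb : 0 < b) (hξ : ξ ≠ 0) :
    ‖b ^ p * ((1 + a * b) ^ (-(finrank ℝ E : ℝ) / 2) * gaussianWeight (b / (1 + a * b)) ξ)‖ ≤
      b ^ p * gaussianMajorant ((finrank ℝ E : ℝ) / 2) (‖ξ‖ ^ 2 * b) := by
  have hg := gaussianWeight_pos (b / (1 + a * b)) ξ
  rw [norm_of_nonneg (by positivity), neg_div]
  gcongr
  exact rpow_mul_gaussianWeight_le (half_pos hn) ha hb hξ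

theorem integrableOn_rpow_mul_gaussianMajorant (hβ : 0 < β) (hβn : β < finrank ℝ E)
    (hξ : ξ ≠ 0) :
    IntegrableOn (fun b => b ^ (β / 2 - 1) *
      gaussianMajorant ((finrank ℝ E : ℝ) / 2) (‖ξ‖ ^ 2 * b)) (Ioi 0) :=
  integrableOn_rpow_mul_comp_mul (by positivity) (integrableOn_rpow_mul_gaussianMajorant_Ioi
    (half_pos hβ) (div_lt_div_of_pos_right hβn two_pos))

theorem integrableOn_rpow_mul_gaussianWeight_div (hβ : 0 < β) (hβn : β < finrank ℝ E) (ha : 0 ≤ a)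
    (hξ : ξ ≠ 0) :
    IntegrableOn (fun b => b ^ (β / 2 - 1) *
      ((1 + a * b) ^ (-(finrank ℝ E : ℝ) / 2) * gaussianWeight (b / (1 + a * b)) ξ)) (Ioi 0) :=
  (integrableOn_rpow_mul_gaussianMajorant hβ hβn hξ).mono'
    (by unfold gaussianWeight; fun_prop) (ae_restrict_of_forall_mem measurableSet_Ioi fun _ hb =>
      norm_rpow_mul_gaussianWeight_div_le (hβ.trans hβn) ha hb hξ)

theorem gaussianWeight_mul_heatKernel_sub_nonneg (ha : 0 < a) (b : ℝ) (η : E) :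
    0 ≤ gaussianWeight b η * heatKernel a (ξ - η) :=
  (mul_pos (gaussianWeight_pos b η) (heatKernel_pos ha _)).le

theorem integral_rpow_mul_gaussianWeight_mul_heatKernel_sub (hβ : 0 < β) {η : E} (hη : η ≠ 0) :
    ∫ b in Ioi 0, (gaussianWeight b η * heatKernel a (ξ - η)) • b ^ (β / 2 - 1) =
      π ^ (-(β / 2)) * Gamma (β / 2) * (‖η‖ ^ (-β) * heatKernel a (ξ - η)) := by
  have h := integral_rpow_mul_gaussianWeight (half_pos hβ) hη
  rw [mul_div_cancel₀ β two_ne_zero] at h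
  rw [← mul_assoc, ← h, ← integral_mul_const]
  exact integral_congr_ae (.of_forall fun b => by
    simp only [smul_eq_mul]
    ring)

variable [FiniteDimensional ℝ E] [MeasurableSpace E] [BorelSpace E]

theorem integrable_gaussianWeight_mul_heatKernel_sub {b : ℝ} (ha : 0 < a) (hb : 0 ≤ b) :
    Integrable fun η : E => gaussianWeight b η * heatKernel a (ξ - η) :=
  ((integrable_heatKernel ha).comp_sub_left ξ).bdd_mul (c := 1)
    continuous_gaussianWeight.aestronglyMeasurable (.of_forall fun η => by
      rw [norm_of_nonneg (gaussianWeight_pos b η).le]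
      exact gaussianWeight_le_one hb η)

theorem integral_norm_rpow_mul_heatKernel_sub (hβ : 0 < β) (hβn : β < finrank ℝ E) (ha : 0 < a)
    (hξ : ξ ≠ 0) :
    Integrable (fun η : E => ‖η‖ ^ (-β) * heatKernel a (ξ - η)) ∧
    π ^ (-(β / 2)) * Gamma (β / 2) * ∫ η : E, ‖η‖ ^ (-β) * heatKernel a (ξ - η) =
      ∫ b in Ioi 0, b ^ (β / 2 - 1) *
        ((1 + a * b) ^ (-(finrank ℝ E : ℝ) / 2) * gaussianWeight (b / (1 + a * b)) ξ) := by
  have : Nontrivial E := nontrivial_of_finrank_pos (R := ℝ) (by exact_mod_cast hβ.trans hβn)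
  have hm : Measurable (Function.uncurry fun b (η : E) =>
      gaussianWeight b η * heatKernel a (ξ - η)) := by
    unfold Function.uncurry gaussianWeight
    fun_prop
  have hF : AEStronglyMeasurable (fun b : ℝ => b ^ (β / 2 - 1)) (volume.restrict (Ioi 0)) := by
    fun_prop
  have hκ₀ : ∀ᵐ b ∂volume.restrict (Ioi 0),
      0 ≤ᵐ[volume] fun η => gaussianWeight b η * heatKernel a (ξ - η) :=
    .of_forall fun b => .of_forall (gaussianWeight_mul_heatKernel_sub_nonneg ha b)
  have hκ : ∀ᵐ b ∂volume.restrict (Ioi 0),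
      Integrable fun η => gaussianWeight b η * heatKernel a (ξ - η) :=
    (ae_restrict_mem measurableSet_Ioi).mono fun b (hb : 0 < b) =>
      integrable_gaussianWeight_mul_heatKernel_sub ha hb.le
  have hb : ∀ b ∈ Ioi (0 : ℝ), b ^ (β / 2 - 1) * ((1 + a * b) ^ (-(finrank ℝ E : ℝ) / 2) *
      gaussianWeight (b / (1 + a * b)) ξ) =
        (∫ η, gaussianWeight b η * heatKernel a (ξ - η)) • b ^ (β / 2 - 1) :=
    fun b (hb : 0 < b) => by
      rw [integral_gaussianWeight_mul_heatKernel_sub ha hb.le, smul_eq_mul, mul_comm]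
  have hi := IntegrableOn.congr_fun
    (integrableOn_rpow_mul_gaussianWeight_div hβ hβn ha.le hξ) hb measurableSet_Ioi
  have hae : (fun η : E => ∫ b in Ioi 0, (gaussianWeight b η * heatKernel a (ξ - η)) •
      b ^ (β / 2 - 1)) =ᵐ[volume] _ := (Measure.ae_ne volume 0).mono fun η hη =>
    integral_rpow_mul_gaussianWeight_mul_heatKernel_sub (a := a) (ξ := ξ) hβ hη
  have hC : IsUnit (π ^ (-(β / 2)) * Gamma (β / 2)) := by
    have := Gamma_pos_of_pos (half_pos hβ)
    exact (show 0 < π ^ (-(β / 2)) * Gamma (β / 2) by positivity).ne'.isUnit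
  refine ⟨(integrable_const_mul_iff hC _).mp
    ((integrable_prod_smul hF hm hκ₀ hκ hi).integral_prod_right.congr hae), ?_⟩
  rw [← integral_const_mul, ← integral_congr_ae hae, integral_integral_smul hF hm hκ₀ hκ hi,
    setIntegral_congr_fun measurableSet_Ioi hb]

/-- The average `‖ξ‖^β (‖·‖^(-β) * h_a)(ξ)` of a homogeneous weight against the heat kernel. -/
noncomputable def heatAverage (β a : ℝ) (ξ : E) : ℝ :=
  ‖ξ‖ ^ β * ∫ η, ‖η‖ ^ (-β) * heatKernel a (ξ - η)

theorem mul_heatAverage (hβ : 0 < β) (hβn : β < finrank ℝ E) (ha : 0 < a) (hξ : ξ ≠ 0) :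
    π ^ (-(β / 2)) * Gamma (β / 2) * heatAverage β a ξ =
      ‖ξ‖ ^ β * ∫ b in Ioi 0, b ^ (β / 2 - 1) *
        ((1 + a * b) ^ (-(finrank ℝ E : ℝ) / 2) * gaussianWeight (b / (1 + a * b)) ξ) := by
  rw [heatAverage, mul_left_comm, (integral_norm_rpow_mul_heatKernel_sub hβ hβn ha hξ).2]

theorem tendsto_heatAverage (hβ : 0 < β) (hβn : β < finrank ℝ E) (hξ : ξ ≠ 0) :
    Tendsto (fun a => heatAverage β a ξ) (𝓝[>] 0) (𝓝 1) := by
  have hC : 0 < π ^ (-(β / 2)) * Gamma (β / 2) := by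
    have := Gamma_pos_of_pos (half_pos hβ)
    positivity
  have hξ' : 0 < ‖ξ‖ := norm_pos_iff.mpr hξ
  have hlim : Tendsto (fun a => ∫ b in Ioi 0, b ^ (β / 2 - 1) *
      ((1 + a * b) ^ (-(finrank ℝ E : ℝ) / 2) * gaussianWeight (b / (1 + a * b)) ξ)) (𝓝[>] 0)
      (𝓝 (∫ b in Ioi (0 : ℝ), b ^ (β / 2 - 1) * gaussianWeight b ξ)) := by
    refine tendsto_integral_filter_of_dominated_convergence _ (.of_forall fun a => by
      unfold gaussianWeight
      fun_prop) ?_ (integrableOn_rpow_mul_gaussianMajorant hβ hβn hξ) ?_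
    · filter_upwards [self_mem_nhdsWithin] with a (ha : 0 < a)
      exact ae_restrict_of_forall_mem measurableSet_Ioi fun b hb =>
        norm_rpow_mul_gaussianWeight_div_le (hβ.trans hβn) ha.le hb hξ
    · refine .of_forall fun b => ?_
      have : ContinuousAt (fun a => b ^ (β / 2 - 1) * ((1 + a * b) ^ (-(finrank ℝ E : ℝ) / 2) *
          gaussianWeight (b / (1 + a * b)) ξ)) 0 := by
        unfold gaussianWeight
        fun_prop (disch := simp)
      simpa using this.tendsto.mono_left nhdsWithin_le_nhds
  have h : Tendsto (fun a => π ^ (-(β / 2)) * Gamma (β / 2) * heatAverage β a ξ) (𝓝[>] 0)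
      (𝓝 (π ^ (-(β / 2)) * Gamma (β / 2) * 1)) := by
    refine ((hlim.const_mul (‖ξ‖ ^ β)).congr' ?_).trans (le_of_eq ?_)
    · filter_upwards [self_mem_nhdsWithin] with a ha using (mul_heatAverage hβ hβn ha hξ).symm
    · rw [integral_rpow_mul_gaussianWeight (half_pos hβ) hξ, mul_left_comm, ← rpow_add hξ']
      simp [mul_div_cancel₀]
  exact (tendsto_const_smul_iff₀ hC.ne').mp h

theorem exists_heatAverage_le (hβ : 0 < β) (hβn : β < finrank ℝ E) :
    ∃ C, ∀ a, 0 < a → ∀ ξ : E, heatAverage β a ξ ≤ C := by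
  have hC : 0 < π ^ (-(β / 2)) * Gamma (β / 2) := by
    have := Gamma_pos_of_pos (half_pos hβ)
    positivity
  set K := ∫ b in Ioi 0, b ^ (β / 2 - 1) * gaussianMajorant ((finrank ℝ E : ℝ) / 2) b
  have hK : 0 ≤ K := setIntegral_nonneg measurableSet_Ioi fun b (hb : 0 < b) =>
    mul_nonneg (by positivity) (gaussianMajorant_nonneg (by positivity) hb)
  refine ⟨(π ^ (-(β / 2)) * Gamma (β / 2))⁻¹ * K, fun a ha ξ => ?_⟩
  rcases eq_or_ne ξ 0 with rfl | hξ
  · rw [heatAverage, norm_zero, zero_rpow hβ.ne', zero_mul]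
    positivity
  have hξ' : 0 < ‖ξ‖ := norm_pos_iff.mpr hξ
  rw [le_inv_mul_iff₀ hC, mul_heatAverage hβ hβn ha hξ]
  calc ‖ξ‖ ^ β * ∫ b in Ioi 0, b ^ (β / 2 - 1) *
        ((1 + a * b) ^ (-(finrank ℝ E : ℝ) / 2) * gaussianWeight (b / (1 + a * b)) ξ)
      ≤ ‖ξ‖ ^ β * ∫ b in Ioi 0, b ^ (β / 2 - 1) *
          gaussianMajorant ((finrank ℝ E : ℝ) / 2) (‖ξ‖ ^ 2 * b) := by
        gcongr ?_ * ?_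
        refine setIntegral_mono_on (integrableOn_rpow_mul_gaussianWeight_div hβ hβn ha.le hξ)
          (integrableOn_rpow_mul_gaussianMajorant hβ hβn hξ) measurableSet_Ioi fun b hb => ?_
        exact (le_abs_self _).trans
          (norm_rpow_mul_gaussianWeight_div_le (hβ.trans hβn) ha.le hb hξ)
    _ = K := by
        rw [integral_rpow_mul_comp_mul (by positivity), ← mul_assoc, ← rpow_natCast,
          ← rpow_mul hξ'.le, ← rpow_add hξ']
        simp [mul_div_cancel₀, K]

end HeatAverage

section Young

theorem mul_mul_le_rpow_add {u k v r q a : ℝ} (hu : 0 ≤ u) (hk : 0 ≤ k) (hv : 0 ≤ v) (hr : 1 ≤ r)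
    (hq : 1 ≤ q) (ha : 1 ≤ a) (h : r⁻¹ + q⁻¹ + a⁻¹ = 2) :
    u * k * v ≤ u ^ r * v ^ q + u ^ r * k ^ a + v ^ q * k ^ a := by
  have hw : ∀ {p : ℝ}, 1 ≤ p → 0 ≤ 1 - p⁻¹ ∧ 1 - p⁻¹ ≤ 1 := fun hp =>
    ⟨sub_nonneg.mpr (inv_le_one_of_one_le₀ hp), sub_le_self _ (by positivity)⟩
  have hsplit : ∀ {x p w₁ w₂ : ℝ}, 0 ≤ x → 1 ≤ p → 0 ≤ w₁ → 0 ≤ w₂ → w₁ + w₂ = p⁻¹ →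
      x = (x ^ p) ^ w₁ * (x ^ p) ^ w₂ := fun hx hp h₁ h₂ h => by
    rw [← rpow_add_of_nonneg (by positivity) h₁ h₂, h, rpow_rpow_inv hx (by positivity)]
  have hru := hsplit hu hr (hw ha).1 (hw hq).1 (by linarith)
  have hqv := hsplit hv hq (hw ha).1 (hw hr).1 (by linarith)
  have hak := hsplit hk ha (hw hq).1 (hw hr).1 (by linarith)
  have hamgm := geom_mean_le_arith_mean3_weighted (hw ha).1 (hw hq).1 (hw hr).1
    (show 0 ≤ u ^ r * v ^ q by positivity) (show 0 ≤ u ^ r * k ^ a by positivity)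
    (show 0 ≤ v ^ q * k ^ a by positivity) (by linarith)
  rw [mul_rpow (by positivity) (by positivity), mul_rpow (by positivity) (by positivity),
    mul_rpow (by positivity) (by positivity)] at hamgm
  calc u * k * v
      ≤ (1 - a⁻¹) * (u ^ r * v ^ q) + (1 - q⁻¹) * (u ^ r * k ^ a) +
          (1 - r⁻¹) * (v ^ q * k ^ a) := by
        refine le_of_eq_of_le ?_ hamgm
        conv_lhs => rw [hru, hqv, hak]
        ring
    _ ≤ u ^ r * v ^ q + u ^ r * k ^ a + v ^ q * k ^ a := by
        refine add_le_add (add_le_add ?_ ?_) ?_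
        · exact mul_le_of_le_one_left (by positivity) (hw ha).2
        · exact mul_le_of_le_one_left (by positivity) (hw hq).2
        · exact mul_le_of_le_one_left (by positivity) (hw hr).2

variable {G : Type*} [NormedAddCommGroup G] [MeasurableSpace G] [BorelSpace G]
  [SecondCountableTopology G] {μ : Measure G} [SFinite μ] [μ.IsAddLeftInvariant] [μ.IsNegInvariant]
  {f g K : G → ℝ}

theorem integrable_mul_comp_sub_mul {r q a : ℝ} (hr : 1 ≤ r) (hq : 1 ≤ q) (ha : 1 ≤ a)
    (h : r⁻¹ + q⁻¹ + a⁻¹ = 2) (hf : MemLp f (.ofReal r) μ) (hK : MemLp K (.ofReal a) μ)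
    (hg : MemLp g (.ofReal q) μ) :
    Integrable (fun z : G × G => f z.1 * K (z.1 - z.2) * g z.2) (μ.prod μ) := by
  have hpow : ∀ {p : ℝ} {u : G → ℝ}, 1 ≤ p → MemLp u (.ofReal p) μ →
      Integrable (fun x => ‖u x‖ ^ p) μ := fun hp hu => by
    simpa [ENNReal.toReal_ofReal (zero_le_one.trans hp)] using
      hu.integrable_norm_rpow (by simpa using one_pos.trans_le hp) ENNReal.ofReal_ne_top
  have hconv : ∀ {u v : G → ℝ}, Integrable u μ → Integrable v μ →
      Integrable (fun z : G × G => u z.2 * v (z.1 - z.2)) (μ.prod μ) := fun hu hv =>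
    hu.convolution_integrand (ContinuousLinearMap.mul ℝ ℝ) hv
  have hfK : Integrable (fun z : G × G => ‖f z.1‖ ^ r * ‖K (z.1 - z.2)‖ ^ a) (μ.prod μ) := by
    refine (hconv (hpow hr hf) (hpow ha hK).comp_neg).swap.congr (.of_forall fun z => ?_)
    simp only [Function.comp_apply, Prod.fst_swap, Prod.snd_swap, neg_sub]
  refine (((hpow hr hf).mul_prod (hpow hq hg)).add hfK |>.add
    (hconv (hpow hq hg) (hpow ha hK))).mono' ?_ (.of_forall fun z => ?_)
  · exact (hf.1.comp_fst.mul (hK.1.comp_quasiMeasurePreserving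
      (quasiMeasurePreserving_sub μ μ))).mul hg.1.comp_snd
  · rw [norm_mul, norm_mul]
    exact mul_mul_le_rpow_add (norm_nonneg _) (norm_nonneg _) (norm_nonneg _) hr hq ha h

theorem memLp_of_integrable_of_memLp {α : Type*} {mα : MeasurableSpace α} {ν : Measure α}
    {u : α → ℝ} {r q : ℝ} (hr : 1 ≤ r) (hrq : r ≤ q) (h : Integrable u ν)
    (hu : MemLp u (.ofReal q) ν) : MemLp u (.ofReal r) ν := by
  have hq : 1 ≤ q := hr.trans hrq
  have hpow : Integrable (fun x => ‖u x‖ ^ q) ν := by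
    simpa [ENNReal.toReal_ofReal (zero_le_one.trans hq)] using
      hu.integrable_norm_rpow (by simpa using one_pos.trans_le hq) ENNReal.ofReal_ne_top
  rw [← integrable_norm_rpow_iff h.1 (by simpa using one_pos.trans_le hr) ENNReal.ofReal_ne_top,
    ENNReal.toReal_ofReal (zero_le_one.trans hr)]
  refine (h.norm.add hpow).mono' (h.1.norm.aemeasurable.pow_const r).aestronglyMeasurable
    (.of_forall fun x => ?_)
  rw [norm_of_nonneg (by positivity)]
  rcases le_total ‖u x‖ 1 with hx | hx
  · exact (rpow_le_self_of_le_one (norm_nonneg _) hx hr).trans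
      (le_add_of_nonneg_right (by positivity))
  · exact (rpow_le_rpow_of_exponent_le hx hrq).trans (le_add_of_nonneg_left (norm_nonneg _))

end Young

section RieszIntegrability

variable {E : Type*} [NormedAddCommGroup E] [NormedSpace ℝ E] [FiniteDimensional ℝ E]
  [MeasurableSpace E] [BorelSpace E] {μ : Measure E} [μ.IsAddHaarMeasure] {γ a : ℝ}

theorem memLp_indicator_ball_norm_rpow (hn : 0 < finrank ℝ E) (ha : 1 ≤ a)
    (h : -(finrank ℝ E : ℝ) < γ * a) :
    MemLp ((Metric.ball (0 : E) 1).indicator fun x => ‖x‖ ^ γ) (.ofReal a) μ := by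
  have hm : AEStronglyMeasurable (fun x : E => ‖x‖ ^ γ) (μ.restrict (Metric.ball 0 1)) :=
    (measurable_norm.pow_const γ).aestronglyMeasurable
  have hpow : AEStronglyMeasurable (fun x : E => ‖‖x‖ ^ γ‖ ^ a) μ :=
    ((measurable_norm.pow_const γ).norm.pow_const a).aestronglyMeasurable
  rw [memLp_indicator_iff_restrict Metric.isOpen_ball.measurableSet,
    ← integrable_norm_rpow_iff hm (by simpa using one_pos.trans_le ha) ENNReal.ofReal_ne_top,
    ENNReal.toReal_ofReal (zero_le_one.trans ha)]
  refine integrableOn_ball_of_norm_le_rpow (C := 1) (α := -(γ * a)) hn (by linarith)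
    (.of_forall fun x => ?_) hpow
  rw [norm_of_nonneg (by positivity), norm_of_nonneg (by positivity), ← rpow_mul (norm_nonneg x),
    neg_neg, one_mul]

theorem memLp_indicator_compl_ball_norm_rpow (ha : 1 ≤ a) (h : γ * a < -(finrank ℝ E : ℝ)) :
    MemLp ((Metric.ball (0 : E) 1)ᶜ.indicator fun x => ‖x‖ ^ γ) (.ofReal a) μ := by
  have hm : AEStronglyMeasurable (fun x : E => ‖x‖ ^ γ) (μ.restrict (Metric.ball 0 1)ᶜ) :=
    (measurable_norm.pow_const γ).aestronglyMeasurable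
  have hγ : γ * a < 0 := h.trans_le (by simp)
  have hpow : AEStronglyMeasurable (fun x : E => ‖‖x‖ ^ γ‖ ^ a) μ :=
    ((measurable_norm.pow_const γ).norm.pow_const a).aestronglyMeasurable
  rw [memLp_indicator_iff_restrict Metric.isOpen_ball.measurableSet.compl,
    ← integrable_norm_rpow_iff hm (by simpa using one_pos.trans_le ha) ENNReal.ofReal_ne_top,
    ENNReal.toReal_ofReal (zero_le_one.trans ha)]
  refine ((integrable_one_add_norm (r := -(γ * a)) (by linarith)).const_mul
    (2 ^ (-(γ * a)))).restrict.mono' hpow.restrict ?_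
  refine ae_restrict_of_forall_mem Metric.isOpen_ball.measurableSet.compl fun x hx => ?_
  have hx : 1 ≤ ‖x‖ := by simpa using hx
  rw [norm_of_nonneg (by positivity), norm_of_nonneg (by positivity), ← rpow_mul (norm_nonneg x),
    neg_neg, rpow_neg two_pos.le, ← div_eq_inv_mul, le_div_iff₀ (by positivity), mul_comm,
    ← mul_rpow two_pos.le (norm_nonneg x)]
  exact rpow_le_rpow_of_nonpos (by positivity) (by linarith) hγ.le

theorem integrable_mul_norm_sub_rpow_mul {α q : ℝ} (hα : 0 < α) (hα' : α < finrank ℝ E)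
    (hq : 2 * (finrank ℝ E : ℝ) / (finrank ℝ E + α) < q) (hq' : q < (finrank ℝ E : ℝ) / α)
    {f τ : E → ℝ} (hf : Integrable f μ) (hfq : MemLp f (.ofReal q) μ)
    (hτ : MemLp τ (.ofReal q) μ) :
    Integrable (fun z : E × E => f z.1 * ‖z.1 - z.2‖ ^ (α - finrank ℝ E) * τ z.2) (μ.prod μ) := by
  have hn : 0 < finrank ℝ E := by exact_mod_cast hα.trans hα'
  set n : ℝ := (finrank ℝ E : ℝ)
  have hq1 : 1 < q := hq.trans_le' ((one_le_div (by linarith)).mpr (by linarith))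
  have hq0 : q * (n + α) > 2 * n := (div_lt_iff₀ (by linarith)).mp hq
  have hq0' : q * α < n := (lt_div_iff₀ hα).mp hq'
  have hf1 : MemLp f (.ofReal 1) μ := by simpa using memLp_one_iff_integrable.mpr hf
  have hconj : 1 < q.conjExponent := (HolderConjugate.conjExponent hq1).symm.lt
  have hinv : q⁻¹ + q.conjExponent⁻¹ = 1 := (HolderConjugate.conjExponent hq1).inv_add_inv_eq_one
  have hfar_exp : (α - n) * q.conjExponent < -n := by
    rw [conjExponent, mul_div_assoc', div_lt_iff₀ (by linarith)]
    linarith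
  have hfar := integrable_mul_comp_sub_mul le_rfl hq1.le hconj.le (by linarith) hf1
    (memLp_indicator_compl_ball_norm_rpow (γ := α - n) hconj.le hfar_exp) hτ
  have hnear : Integrable (fun z : E × E => f z.1 * (Metric.ball (0 : E) 1).indicator
      (fun x => ‖x‖ ^ (α - n)) (z.1 - z.2) * τ z.2) (μ.prod μ) := by
    -- The truncated kernel is in `L^a` only for `a < n / (n - α)`: pair it with `f ∈ L^q` if
    -- `q ≤ 2`, and with `f` in the dual of `L^q`, by interpolation with `L^1`, if `2 ≤ q`.
    rcases le_total q 2 with h2 | h2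
    · have ha : 1 ≤ q / (2 * (q - 1)) := (one_le_div (by linarith)).mpr (by linarith)
      refine integrable_mul_comp_sub_mul hq1.le hq1.le ha ?_ hfq
        (memLp_indicator_ball_norm_rpow hn ha ?_) hτ
      · field_simp
        ring
      · rw [mul_div_assoc', lt_div_iff₀ (by linarith)]
        linarith
    · have hconj_le : q.conjExponent ≤ q := by
        rw [conjExponent, div_le_iff₀ (by linarith)]
        nlinarith
      exact integrable_mul_comp_sub_mul hconj.le hq1.le le_rfl (by linarith)
        (memLp_of_integrable_of_memLp hconj.le hconj_le hf hfq)
        (memLp_indicator_ball_norm_rpow hn le_rfl (by linarith)) hτ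
  refine (hnear.add hfar).congr (.of_forall fun z => ?_)
  rw [Pi.add_apply, ← add_mul, ← mul_add, indicator_self_add_compl_apply]

end RieszIntegrability

section SmoothCutoff

variable {E : Type*} [NormedAddCommGroup E] [InnerProductSpace ℝ E] [FiniteDimensional ℝ E]

theorem exists_schwartz_hasCompactSupport_eq_one : ∃ ψ : 𝓢(E, ℂ), HasCompactSupport ψ ∧
    (∀ x, ‖ψ x‖ ≤ 1) ∧ ψ 0 = 1 := by
  let χ : ContDiffBump (0 : E) := default
  have hχ : HasCompactSupport (fun x => (χ x : ℂ)) :=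
    χ.hasCompactSupport.comp_left (g := Complex.ofReal) rfl
  refine ⟨hχ.toSchwartzMap (Complex.ofRealCLM.contDiff.comp χ.contDiff), hχ, fun x => ?_, ?_⟩
  · exact (Complex.norm_real _).trans_le ((norm_of_nonneg χ.nonneg).trans_le χ.le_one)
  · exact congrArg Complex.ofReal
      (χ.one_of_mem_closedBall (Metric.mem_closedBall_self χ.rIn_pos.le))

variable [MeasurableSpace E] [BorelSpace E] {φ : E → ℂ}

theorem fourier_schwartz_smul_mul (ψ : 𝓢(E, ℂ)) (hφ : Integrable φ) (c : ℝ) (ζ : E) :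
    𝓕 (fun x => ψ (c • x) * φ x) ζ = ∫ z, 𝓕 ψ z * 𝓕 φ (ζ - c • z) := by
  have hmod : Integrable (fun x => fourierChar (-⟪x, ζ⟫) • φ x) :=
    (Real.fourierIntegral_convergent_iff ζ).mpr hφ
  have hflip := VectorFourier.integral_fourierIntegral_smul_eq_flip (μ := (volume : Measure E))
    (ν := volume) (e := fourierChar) (L := (-c) • innerₗ E) continuous_fourierChar
    (by
      simp only [LinearMap.smul_apply, innerₗ_apply_apply]
      fun_prop) (𝓕 ψ).integrable hmod
  have hinv : ∀ x, VectorFourier.fourierIntegral fourierChar volume ((-c) • innerₗ E)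
      (𝓕 ψ : 𝓢(E, ℂ)) x = ψ (c • x) := fun x => by
    conv_rhs => rw [← FourierTransform.fourierInv_fourier_eq (F := 𝓢(E, ℂ)) ψ]
    rw [fourierInv_coe, Real.fourierInv_eq]
    simp [VectorFourier.fourierIntegral, inner_smul_right]
  have hshift : ∀ z, VectorFourier.fourierIntegral fourierChar volume ((-c) • innerₗ E).flip
      (fun x => fourierChar (-⟪x, ζ⟫) • φ x) z = 𝓕 φ (ζ - c • z) := fun z => by
    rw [Real.fourier_eq]
    refine integral_congr_ae (.of_forall fun x => ?_)
    simp only [LinearMap.flip_apply, LinearMap.smul_apply, innerₗ_apply_apply, smul_smul,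
      ← AddChar.map_add_eq_mul, inner_sub_right, inner_smul_right, real_inner_comm x z]
    congr 3
    simp only [smul_eq_mul]
    ring
  simp only [hinv, hshift, smul_eq_mul] at hflip
  rw [← hflip, Real.fourier_eq]
  refine integral_congr_ae (.of_forall fun x => ?_)
  simp only [Circle.smul_def, smul_eq_mul]
  ring

theorem integrable_one_add_norm_pow_mul_norm_schwartz (ψ : 𝓢(E, ℂ)) (N : ℕ) :
    Integrable (fun z => (1 + ‖z‖) ^ N * ‖ψ z‖) := by
  simp only [add_comm (1 : ℝ), add_pow, one_pow, mul_one, Finset.sum_mul]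
  exact integrable_finsetSum _ fun k _ =>
    ((ψ.integrable_pow_mul volume k).const_mul (N.choose k : ℝ)).congr (.of_forall fun z => by ring)

theorem one_add_norm_pow_mul_norm_fourier_schwartz_smul_mul_le (ψ : 𝓢(E, ℂ))
    (hφ : Integrable φ) {N : ℕ} {C : ℝ} (hC : ∀ ζ, (1 + ‖ζ‖) ^ N * ‖𝓕 φ ζ‖ ≤ C) {c : ℝ}
    (hc₀ : 0 ≤ c) (hc₁ : c ≤ 1) (ζ : E) :
    (1 + ‖ζ‖) ^ N * ‖𝓕 (fun x => ψ (c • x) * φ x) ζ‖ ≤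
      C * ∫ z, (1 + ‖z‖) ^ N * ‖𝓕 ψ z‖ := by
  have hpeetre : ∀ z : E, 1 + ‖ζ‖ ≤ (1 + ‖z‖) * (1 + ‖ζ - c • z‖) := fun z => by
    have h₁ : ‖ζ‖ ≤ ‖c • z‖ + ‖ζ - c • z‖ := norm_le_insert' ζ (c • z) |>.trans_eq (by abel)
    have h₂ : ‖c • z‖ ≤ ‖z‖ := by
      rw [norm_smul, norm_of_nonneg hc₀]
      exact mul_le_of_le_one_left (norm_nonneg z) hc₁
    nlinarith [norm_nonneg z, norm_nonneg (ζ - c • z)]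
  rw [fourier_schwartz_smul_mul ψ hφ, ← integral_const_mul]
  calc (1 + ‖ζ‖) ^ N * ‖∫ z, 𝓕 ψ z * 𝓕 φ (ζ - c • z)‖
      = ‖∫ z, ((1 + ‖ζ‖) ^ N) • (𝓕 ψ z * 𝓕 φ (ζ - c • z))‖ := by
        rw [integral_smul, norm_smul, norm_of_nonneg (by positivity)]
    _ ≤ ∫ z, C * ((1 + ‖z‖) ^ N * ‖𝓕 ψ z‖) := by
        refine norm_integral_le_of_norm_le
          ((integrable_one_add_norm_pow_mul_norm_schwartz (𝓕 ψ) N).const_mul C)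
          (.of_forall fun z => ?_)
        rw [norm_smul, norm_mul, norm_of_nonneg (by positivity)]
        calc (1 + ‖ζ‖) ^ N * (‖𝓕 ψ z‖ * ‖𝓕 φ (ζ - c • z)‖)
            ≤ ((1 + ‖z‖) * (1 + ‖ζ - c • z‖)) ^ N * (‖𝓕 ψ z‖ * ‖𝓕 φ (ζ - c • z)‖) := by
              gcongr
              exact hpeetre z
          _ = (1 + ‖ζ - c • z‖) ^ N * ‖𝓕 φ (ζ - c • z)‖ * ((1 + ‖z‖) ^ N * ‖𝓕 ψ z‖) := by
              rw [mul_pow]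
              ring
          _ ≤ C * ((1 + ‖z‖) ^ N * ‖𝓕 ψ z‖) := by
              gcongr
              exact hC _

theorem tendsto_integral_schwartz_smul_mul {ψ : 𝓢(E, ℂ)} (hψ : ∀ x, ‖ψ x‖ ≤ 1) (hψ₀ : ψ 0 = 1)
    {g : E → ℂ} (hg : Integrable g) :
    Tendsto (fun c : ℝ => ∫ x, ψ (c • x) * g x) (𝓝[>] 0) (𝓝 (∫ x, g x)) := by
  have hlim : ∀ x, Tendsto (fun c : ℝ => ψ (c • x)) (𝓝[>] 0) (𝓝 1) := fun x =>
    ((ψ.continuous.comp (continuous_id.smul continuous_const)).tendsto' (0 : ℝ) 1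
      (by simp [hψ₀])).mono_left nhdsWithin_le_nhds
  refine tendsto_integral_filter_of_dominated_convergence (fun x => ‖g x‖)
    (.of_forall fun c => ?_) (.of_forall fun c => .of_forall fun x => ?_) hg.norm
    (.of_forall fun x => by simpa using (hlim x).mul_const (g x))
  · exact (ψ.continuous.comp (continuous_const_smul c)).aestronglyMeasurable.mul hg.1
  · rw [norm_mul]
    exact mul_le_of_le_one_left (norm_nonneg _) (hψ _)

/-- The function `u` is the Fourier transform of `v` in the sense of distributions, tested against
smooth compactly supported functions. The exponent `N` bounds the growth of `v` in mean, which makes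
`v` a tempered distribution. -/
structure IsDistributionalFourier (N : ℕ) (u v : E → ℂ) : Prop where
  aestronglyMeasurable : AEStronglyMeasurable v
  integrable : Integrable (fun ξ => ‖v ξ‖ * ((1 + ‖ξ‖) ^ N)⁻¹)
  integral_eq : ∀ χ : E → ℂ, ContDiff ℝ ∞ χ → HasCompactSupport χ →
    ∫ x, u x * χ x = ∫ ξ, v ξ * 𝓕 χ ξ

theorem IsDistributionalFourier.integral_eq_of_decay {u v : E → ℂ} {N : ℕ} {C : ℝ}
    (huv : IsDistributionalFourier N u v)
    (hφ : ContDiff ℝ ∞ φ) (hφi : Integrable φ) (huφ : Integrable (fun x => u x * φ x))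
    (hC : ∀ ζ, (1 + ‖ζ‖) ^ N * ‖𝓕 φ ζ‖ ≤ C) :
    ∫ x, u x * φ x = ∫ ξ, v ξ * 𝓕 φ ξ := by
  obtain ⟨ψ, hψ_supp, hψ, hψ₀⟩ := exists_schwartz_hasCompactSupport_eq_one (E := E)
  have hcut : ∀ c : ℝ, 0 < c → ∫ x, ψ (c • x) * (u x * φ x) =
      ∫ ξ, v ξ * 𝓕 (fun x => ψ (c • x) * φ x) ξ := fun c hc => by
    rw [← huv.integral_eq (fun x => ψ (c • x) * φ x)
      ((ψ.smooth'.comp (contDiff_const_smul c)).mul hφ) (hψ_supp.comp_smul hc.ne').mul_right]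
    exact integral_congr_ae (.of_forall fun x => mul_left_comm _ _ _)
  have hmeas : ∀ c : ℝ, AEStronglyMeasurable (𝓕 (fun x => ψ (c • x) * φ x)) := fun c =>
    (VectorFourier.fourierIntegral_continuous continuous_fourierChar
      (by exact continuous_inner) (hφi.bdd_mul
        (ψ.continuous.comp (continuous_const_smul c)).aestronglyMeasurable
        (.of_forall fun x => hψ _))).aestronglyMeasurable
  have hfourier : ∀ ζ, Tendsto (fun c : ℝ => 𝓕 (fun x => ψ (c • x) * φ x) ζ) (𝓝[>] 0)
      (𝓝 (𝓕 φ ζ)) := fun ζ => by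
    simp only [Real.fourier_eq, ← mul_smul_comm]
    exact tendsto_integral_schwartz_smul_mul hψ hψ₀
      ((Real.fourierIntegral_convergent_iff ζ).mpr hφi)
  refine tendsto_nhds_unique (tendsto_integral_schwartz_smul_mul hψ hψ₀ huφ) <|
    Tendsto.congr' (eventually_mem_nhdsWithin.mono fun c hc => (hcut c hc).symm) <|
    tendsto_integral_filter_of_dominated_convergence
      (fun ξ => ‖v ξ‖ * ((1 + ‖ξ‖) ^ N)⁻¹ * (C * ∫ z, (1 + ‖z‖) ^ N * ‖𝓕 ψ z‖))
      (.of_forall fun c => huv.aestronglyMeasurable.mul (hmeas c)) ?_ (huv.integrable.mul_const _)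
      (.of_forall fun ξ => (hfourier ξ).const_mul _)
  filter_upwards [Ioc_mem_nhdsGT zero_lt_one] with c hc
  refine .of_forall fun ξ => ?_
  rw [norm_mul, mul_assoc]
  gcongr
  rw [← div_eq_inv_mul, le_div_iff₀' (by positivity)]
  exact one_add_norm_pow_mul_norm_fourier_schwartz_smul_mul_le ψ hφi hC hc.1.le hc.2 ξ

end SmoothCutoff

section DualRepresentation

theorem exists_mem_closure_range_inner_eq {𝕜 V H : Type*} [RCLike 𝕜] [SeminormedAddCommGroup V]
    [NormedSpace 𝕜 V] [NormedAddCommGroup H] [InnerProductSpace 𝕜 H] [CompleteSpace H]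
    (L : V →ₗᵢ[𝕜] H) (T : StrongDual 𝕜 V) :
    ∃ G ∈ closure (range L), ‖G‖ = ‖T‖ ∧ ∀ v, T v = inner 𝕜 G (L v) := by
  let K := L.toLinearMap.range.topologicalClosure
  let e : V →ₗ[𝕜] K := L.toLinearMap.codRestrict K fun v => subset_closure ⟨v, rfl⟩
  have he : DenseRange e := fun x => by
    rw [closure_subtype, ← range_comp]
    exact x.2
  have hT : ∀ v, ‖T v‖ ≤ ‖T‖ * ‖e v‖ := fun v =>
    (T.le_opNorm v).trans_eq (by rw [← L.norm_map v]; rfl)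
  let G := (InnerProductSpace.toDual 𝕜 K).symm (T.toLinearMap.extendOfNorm e)
  have hG : ∀ v, T v = inner 𝕜 (G : H) (L v) := fun v => by
    have h := InnerProductSpace.toDual_symm_apply (x := e v)
      (y := T.toLinearMap.extendOfNorm e)
    rw [LinearMap.extendOfNorm_eq he ⟨_, hT⟩] at h
    exact h.symm
  refine ⟨G, G.2, le_antisymm ?_ (T.opNorm_le_bound (norm_nonneg _) fun v => ?_), hG⟩
  · exact ((InnerProductSpace.toDual 𝕜 K).symm.norm_map _).trans_le
      (LinearMap.opNorm_extendOfNorm_le he (norm_nonneg T) hT)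
  · rw [hG]
    exact (norm_inner_le_norm _ _).trans_eq (by rw [L.norm_map])

variable {d : ℕ}

theorem exists_schwartz_eq_conj_comp_neg (φ : 𝓢(EuclideanSpace ℝ (Fin d), ℂ)) :
    ∃ ψ : 𝓢(EuclideanSpace ℝ (Fin d), ℂ), ∀ x, ψ x = conj (φ (-x)) :=
  ⟨(compCLMOfContinuousLinearEquiv ℝ (.neg ℝ) φ).postcompCLM Complex.conjCLE.toContinuousLinearMap,
    fun _ => rfl⟩

theorem unitaryFourier_conj_comp_neg (φ : EuclideanSpace ℝ (Fin d) → ℂ)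
    (ξ : EuclideanSpace ℝ (Fin d)) :
    unitaryFourier (fun x => conj (φ (-x))) ξ = conj (unitaryFourier φ ξ) := by
  rw [unitaryFourier, unitaryFourier, map_mul, Complex.conj_ofReal, ← integral_conj,
    ← integral_neg_eq_self]
  simp [← Complex.exp_conj]

theorem HasFourierTransform.conj_comp_neg {u : EuclideanSpace ℝ (Fin d) → ℝ}
    {g : EuclideanSpace ℝ (Fin d) → ℂ} (h : HasFourierTransform u g) :
    HasFourierTransform u (fun ξ => conj (g (-ξ))) := by
  have hloc : LocallyIntegrable (fun ξ => g (-ξ)) := by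
    refine (locallyIntegrable_map_homeomorph (Homeomorph.neg _)).mp ?_
    rw [Homeomorph.coe_neg, Measure.map_neg_eq_self]
    exact h.1
  refine ⟨hloc.mono (Complex.continuous_conj.comp_aestronglyMeasurable hloc.aestronglyMeasurable)
    (.of_forall fun ξ => (RCLike.norm_conj _).le), fun φ => ?_⟩
  obtain ⟨ψ, hψ⟩ := exists_schwartz_eq_conj_comp_neg φ
  obtain ⟨hg, hu, hgu⟩ := h.2 ψ
  have hψF : ∀ x, unitaryFourier ψ x = conj (unitaryFourier φ x) := fun x => by
    rw [← unitaryFourier_conj_comp_neg, funext hψ]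
  have hconj : ∀ x, conj ((u x : ℂ) * unitaryFourier ψ x) = u x * unitaryFourier φ x := fun x => by
    rw [map_mul, Complex.conj_ofReal, hψF, Complex.conj_conj]
  have hconj' : ∀ ξ, conj (g (-ξ) * ψ (-ξ)) = conj (g (-ξ)) * φ ξ := fun ξ => by
    rw [map_mul, hψ, neg_neg, Complex.conj_conj]
  refine ⟨?_, ?_, ?_⟩
  · simp only [← hconj']
    exact Complex.conjCLE.toContinuousLinearMap.integrable_comp hg.comp_neg
  · simp only [← hconj]
    exact Complex.conjCLE.toContinuousLinearMap.integrable_comp hu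
  · simp only [← hconj, ← hconj', integral_conj, ← hgu]
    rw [integral_neg_eq_self (fun ξ => g ξ * ψ ξ)]

theorem HomSobolev.ae_toL2_neg {s : ℝ} (v : HomSobolev d s) :
    ∀ᵐ ξ, toL2 d s v (-ξ) = conj (toL2 d s v ξ) := by
  have h : toL2 d s v =ᵐ[volume] fun ξ => ‖ξ‖ ^ s • v.fourier ξ := v.memLp_fourier.coeFn_toLp
  filter_upwards [h, (Measure.measurePreserving_neg volume).quasiMeasurePreserving.ae h,
    v.hasFourierTransform_fourier.ae_unique v.hasFourierTransform_fourier.conj_comp_neg]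
    with ξ h₁ h₂ h₃
  rw [h₁, h₂, h₃, norm_neg, Complex.real_smul, Complex.real_smul, map_mul, Complex.conj_conj,
    Complex.conj_ofReal]

theorem isClosed_setOf_ae_neg_eq_conj {E : Type*} [NormedAddCommGroup E] [InnerProductSpace ℝ E]
    [FiniteDimensional ℝ E] [MeasurableSpace E] [BorelSpace E] {p : ℝ≥0∞} [Fact (1 ≤ p)] :
    IsClosed {f : Lp ℂ p (volume : Measure E) | ∀ᵐ ξ, f (-ξ) = conj (f ξ)} := by
  have hneg := Measure.measurePreserving_neg (volume : Measure E)
  have hconj : Continuous ((Complex.conjCLE : ℂ →L[ℝ] ℂ).compLpL p (volume : Measure E)) :=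
    ContinuousLinearMap.continuous _
  convert isClosed_eq (Lp.isometry_compMeasurePreserving hneg).continuous hconj using 1
  ext f
  have h₁ := Lp.coeFn_compMeasurePreserving f hneg
  have h₂ := (Complex.conjCLE : ℂ →L[ℝ] ℂ).coeFn_compLpL f
  rw [mem_ofPred_eq, mem_ofPred_eq, Lp.ext_iff]
  constructor <;> intro h <;> filter_upwards [h₁, h₂, h] with ξ h₁ h₂ h
  · rw [h₁, h₂, Function.comp_apply, h]
    rfl
  · rw [h₁, h₂] at h
    exact h

theorem HomSobolev.exists_hermitian_representation {s : ℝ} (T : StrongDual ℝ (HomSobolev d s)) :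
    ∃ G : Lp ℂ 2 (volume : Measure (EuclideanSpace ℝ (Fin d))),
      (∀ᵐ ξ, G (-ξ) = conj (G ξ)) ∧ ‖G‖ = ‖T‖ ∧
      ∀ v : HomSobolev d s, (T v : ℂ) = ∫ ξ, conj (G ξ) * (‖ξ‖ ^ s • v.fourier ξ) := by
  obtain ⟨G, hG, hGn, hT⟩ :=
    exists_mem_closure_range_inner_eq ⟨toL2 d s, fun _ => rfl⟩ T
  have hsub : closure (range (toL2 d s)) ⊆ {f | ∀ᵐ ξ, f (-ξ) = conj (f ξ)} :=
    closure_minimal (range_subset_iff.mpr ae_toL2_neg) isClosed_setOf_ae_neg_eq_conj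
  have hGs : ∀ᵐ ξ, G (-ξ) = conj (G ξ) := hsub hG
  refine ⟨G, hGs, hGn, fun v => ?_⟩
  have hv : toL2 d s v =ᵐ[volume] fun ξ => ‖ξ‖ ^ s • v.fourier ξ := v.memLp_fourier.coeFn_toLp
  have hint : Integrable (fun ξ => conj (G ξ) * toL2 d s v ξ) :=
    (Lp.memLp G).star.integrable_mul (Lp.memLp (toL2 d s v))
  have hreal : conj (∫ ξ, conj (G ξ) * toL2 d s v ξ) = ∫ ξ, conj (G ξ) * toL2 d s v ξ := by
    rw [← integral_conj, ← integral_neg_eq_self]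
    refine integral_congr_ae ?_
    filter_upwards [hGs, v.ae_toL2_neg] with ξ h₁ h₂
    rw [h₁, h₂, map_mul, Complex.conj_conj, Complex.conj_conj]
  have hre : T v = (∫ ξ, conj (G ξ) * toL2 d s v ξ).re := by
    rw [hT, L2.inner_def, ← RCLike.re_eq_complex_re, ← integral_re hint]
    exact integral_congr_ae (.of_forall fun ξ => (Complex.inner _ _).trans (by simp [mul_comm]))
  rw [hre, Complex.conj_eq_iff_re.mp hreal]
  refine integral_congr_ae ?_
  filter_upwards [hv] with ξ hξ
  rw [hξ]

end DualRepresentation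

section FourierPairing

theorem exists_one_add_norm_pow_mul_norm_schwartz_le {E : Type*}
    [NormedAddCommGroup E] [InnerProductSpace ℝ E] (ψ : 𝓢(E, ℂ)) (N : ℕ) :
    ∃ C, ∀ ξ, (1 + ‖ξ‖) ^ N * ‖ψ ξ‖ ≤ C :=
  ⟨_, fun ξ => by
    simpa using one_add_le_sup_seminorm_apply (𝕜 := ℝ) (m := (N, 0)) le_rfl le_rfl ψ ξ⟩

variable {E : Type*} [NormedAddCommGroup E] [InnerProductSpace ℝ E] [FiniteDimensional ℝ E]
  [MeasurableSpace E] [BorelSpace E] {u v : E → ℂ}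

theorem memLp_two_rpow_mul_one_add_norm_pow_inv {r s : ℝ} (hr : 0 ≤ r) (hs : 0 ≤ s) {N : ℕ}
    (hN : s + finrank ℝ E / 2 < N) :
    MemLp (fun ξ : E => (r * ‖ξ‖) ^ s * ((1 + ‖ξ‖) ^ N)⁻¹) 2 := by
  have hpos : ∀ ξ : E, 0 < 1 + ‖ξ‖ := fun ξ => by positivity
  have hcont : Continuous fun ξ : E => (r * ‖ξ‖) ^ s * ((1 + ‖ξ‖) ^ N)⁻¹ :=
    ((continuous_const.mul continuous_norm).rpow_const fun _ => .inr hs).mul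
      (((continuous_const.add continuous_norm).pow N).inv₀ fun ξ => (pow_pos (hpos ξ) N).ne')
  rw [memLp_two_iff_integrable_sq hcont.aestronglyMeasurable]
  have hdecay : Integrable (fun ξ : E => (r ^ s) ^ 2 * (1 + ‖ξ‖) ^ (-(2 * N - 2 * s))) :=
    (integrable_one_add_norm (by linarith)).const_mul _
  refine hdecay.mono' (hcont.pow 2).aestronglyMeasurable (.of_forall fun ξ => ?_)
  calc ‖((r * ‖ξ‖) ^ s * ((1 + ‖ξ‖) ^ N)⁻¹) ^ 2‖
      = ((r * ‖ξ‖) ^ s * ((1 + ‖ξ‖) ^ N)⁻¹) ^ 2 := norm_of_nonneg (by positivity)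
    _ ≤ ((r * (1 + ‖ξ‖)) ^ s * ((1 + ‖ξ‖) ^ N)⁻¹) ^ 2 := by
        gcongr
        linarith
    _ = (r ^ s) ^ 2 * (1 + ‖ξ‖) ^ (-(2 * N - 2 * s)) := by
        rw [mul_rpow hr (hpos ξ).le, mul_assoc, mul_pow, ← rpow_natCast _ N, ← rpow_neg (hpos ξ).le,
          ← rpow_add (hpos ξ), ← rpow_mul_natCast (hpos ξ).le]
        congr 2
        push_cast
        ring

theorem integrable_norm_mul_rpow_mul_one_add_norm_pow_inv {H : E → ℂ} (hH : MemLp H 2) {r s : ℝ}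
    (hr : 0 ≤ r) (hs : 0 ≤ s) {N : ℕ} (hN : s + finrank ℝ E / 2 < N) :
    Integrable (fun ξ => ‖H ξ * ((r * ‖ξ‖) ^ s : ℝ)‖ * ((1 + ‖ξ‖) ^ N)⁻¹) := by
  refine (hH.norm.integrable_mul (memLp_two_rpow_mul_one_add_norm_pow_inv hr hs hN)).congr
    (.of_forall fun ξ => ?_)
  simp only [Pi.mul_apply, norm_mul, Complex.norm_real]
  rw [norm_of_nonneg (by positivity), mul_assoc]

theorem integrable_mul_of_decay {φ : E → ℂ} (hvm : AEStronglyMeasurable v) {N : ℕ} {C : ℝ}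
    (hv : Integrable (fun ξ => ‖v ξ‖ * ((1 + ‖ξ‖) ^ N)⁻¹)) (hφm : AEStronglyMeasurable φ)
    (hC : ∀ ξ, (1 + ‖ξ‖) ^ N * ‖φ ξ‖ ≤ C) : Integrable (fun ξ => v ξ * φ ξ) := by
  refine (hv.mul_const C).mono' (hvm.mul hφm) (.of_forall fun ξ => ?_)
  rw [norm_mul, mul_assoc]
  gcongr
  rw [← div_eq_inv_mul, le_div_iff₀' (by positivity)]
  exact hC ξ

theorem integral_mul_eq_integral_mul_fourier_of_real (hu : LocallyIntegrable u)
    (hvm : AEStronglyMeasurable v) {N : ℕ} (hv : Integrable (fun ξ => ‖v ξ‖ * ((1 + ‖ξ‖) ^ N)⁻¹))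
    (huv : ∀ χ : E → ℝ, ContDiff ℝ ∞ χ → HasCompactSupport χ →
      ∫ x, u x * χ x = ∫ ξ, v ξ * 𝓕 (fun x => (χ x : ℂ)) ξ)
    {χ : E → ℂ} (hχ : ContDiff ℝ ∞ χ) (hχs : HasCompactSupport χ) :
    ∫ x, u x * χ x = ∫ ξ, v ξ * 𝓕 χ ξ := by
  have hreal : ∀ f : E → ℝ, ContDiff ℝ ∞ f → HasCompactSupport f → ∃ ψ : 𝓢(E, ℂ),
      (∀ x, ψ x = f x) ∧ Integrable (fun x => u x * ψ x) ∧ Integrable (fun ξ => v ξ * 𝓕 ψ ξ) ∧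
      ∫ x, u x * ψ x = ∫ ξ, v ξ * 𝓕 ψ ξ := fun f hf hfs => by
    have hs : HasCompactSupport (fun x => (f x : ℂ)) := hfs.comp_left (g := Complex.ofReal) rfl
    let ψ := hs.toSchwartzMap (Complex.ofRealCLM.contDiff.comp hf)
    obtain ⟨C, hC⟩ := exists_one_add_norm_pow_mul_norm_schwartz_le (𝓕 ψ) N
    refine ⟨ψ, fun x => rfl, ?_, integrable_mul_of_decay hvm hv
      (𝓕 ψ).continuous.aestronglyMeasurable hC, ?_⟩
    · exact (hu.integrable_smul_right_of_hasCompactSupport ψ.continuous hs)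
    · rw [fourier_coe]
      exact huv f hf hfs
  obtain ⟨ψ, hψ, huψ, hvψ, hψe⟩ := hreal (fun x => (χ x).re) (Complex.reCLM.contDiff.comp hχ)
    (hχs.comp_left (g := Complex.re) rfl)
  obtain ⟨θ, hθ, huθ, hvθ, hθe⟩ := hreal (fun x => (χ x).im) (Complex.imCLM.contDiff.comp hχ)
    (hχs.comp_left (g := Complex.im) rfl)
  have hsum : χ = (ψ + Complex.I • θ : 𝓢(E, ℂ)) := funext fun x => by
    simp [hψ, hθ, mul_comm Complex.I]
  rw [hsum, ← fourier_coe, FourierTransform.fourier_add, FourierTransform.fourier_smul]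
  simp only [add_apply, smul_apply, smul_eq_mul, mul_add, mul_left_comm _ Complex.I]
  rw [integral_add huψ (huθ.const_mul _), integral_add hvψ (hvθ.const_mul _),
    integral_const_mul, integral_const_mul, hψe, hθe]

variable {d : ℕ}

theorem HomSobolev.IsRegularDistribution.integral_mul_eq {s : ℝ} (hs : 0 ≤ s)
    {T : StrongDual ℝ (HomSobolev d s)} {τ : EuclideanSpace ℝ (Fin d) → ℝ}
    (hT : IsRegularDistribution T τ) {G : EuclideanSpace ℝ (Fin d) → ℂ}
    (hG : ∀ v : HomSobolev d s, (T v : ℂ) = ∫ ξ, conj (G ξ) * (‖ξ‖ ^ s • v.fourier ξ))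
    {χ : EuclideanSpace ℝ (Fin d) → ℝ} (hχ : ContDiff ℝ ∞ χ) (hχs : HasCompactSupport χ) :
    ∫ x, (τ x : ℂ) * χ x =
      ∫ ξ, ((2 * π) ^ ((d : ℝ) / 2) : ℝ) * conj (G ((2 * π) • ξ)) *
        ((2 * π * ‖ξ‖) ^ s : ℝ) * 𝓕 (fun x => (χ x : ℂ)) ξ := by
  have hp : (0 : ℝ) < 2 * π := by positivity
  obtain ⟨u, hu⟩ := exists_of_test (d := d) hs χ hχ hχs
  have hs' : HasCompactSupport (fun x => (χ x : ℂ)) := hχs.comp_left (g := Complex.ofReal) rfl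
  have hF := u.hasFourierTransform_fourier.ae_unique ((hasFourierTransform_of_schwartz χ
    (hs'.toSchwartzMap (Complex.ofRealCLM.contDiff.comp hχ)) fun x => rfl).congr hu.symm)
  have hscale := Measure.integral_comp_smul (volume : Measure (EuclideanSpace ℝ (Fin d)))
    (fun ξ => conj (G ξ) * (‖ξ‖ ^ s • unitaryFourier (fun x => (χ x : ℂ)) ξ)) (2 * π)
  rw [finrank_euclideanSpace_fin, abs_of_pos (by positivity), eq_inv_smul_iff₀ (by positivity),
    ← integral_smul] at hscale
  have hconst : (2 * π) ^ ((d : ℝ) / 2) = (2 * π) ^ d * (2 * π) ^ (-(d : ℝ) / 2) := by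
    rw [← rpow_natCast, ← rpow_add hp]
    ring_nf
  calc ∫ x, (τ x : ℂ) * χ x = (T u : ℂ) := by
        rw [hT χ hχ hχs u hu, ← integral_complex_ofReal]
        push_cast
        rfl
    _ = ∫ ξ, conj (G ξ) * (‖ξ‖ ^ s • unitaryFourier (fun x => (χ x : ℂ)) ξ) := by
        rw [hG]
        refine integral_congr_ae ?_
        filter_upwards [hF] with ξ hξ
        rw [hξ]
        rfl
    _ = _ := by
        rw [← hscale]
        refine integral_congr_ae (.of_forall fun ξ => ?_)
        simp only [unitaryFourier_eq, smul_smul, inv_mul_cancel₀ hp.ne', one_smul, norm_smul,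
          norm_of_nonneg hp.le, hconst, Complex.real_smul]
        push_cast
        ring

theorem integral_norm_sq_rescale (G : Lp ℂ 2 (volume : Measure (EuclideanSpace ℝ (Fin d)))) :
    ∫ ξ, ‖((2 * π) ^ ((d : ℝ) / 2) : ℝ) * conj (G ((2 * π) • ξ))‖ ^ 2 = ‖G‖ ^ 2 := by
  have hp : (0 : ℝ) < 2 * π := by positivity
  have hscale := Measure.integral_comp_smul (volume : Measure (EuclideanSpace ℝ (Fin d)))
    (fun ξ => ‖G ξ‖ ^ 2) (2 * π)
  rw [finrank_euclideanSpace_fin, abs_of_pos (by positivity), eq_inv_smul_iff₀ (by positivity),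
    ← integral_smul] at hscale
  have hconst : ((2 * π) ^ ((d : ℝ) / 2)) ^ 2 = (2 * π) ^ d := by
    rw [← rpow_mul_natCast hp.le, ← rpow_natCast]
    congr 1
    push_cast
    ring
  simp only [norm_mul, Complex.norm_real, RCLike.norm_conj, mul_pow, norm_eq_abs, sq_abs, hconst]
  rw [← real_inner_self_eq_norm_sq, L2.inner_def]
  simpa only [real_inner_self_eq_norm_sq, smul_eq_mul, mul_pow] using hscale

theorem HomSobolev.IsRegularDistribution.exists_fourier_density {s : ℝ} (hs : 0 ≤ s)
    {T : StrongDual ℝ (HomSobolev d s)} {τ : EuclideanSpace ℝ (Fin d) → ℝ}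
    (hT : IsRegularDistribution T τ) (hτ : LocallyIntegrable τ) :
    ∃ H : EuclideanSpace ℝ (Fin d) → ℂ, MemLp H 2 ∧ (∀ᵐ ξ, H (-ξ) = conj (H ξ)) ∧
      ∫ ξ, ‖H ξ‖ ^ 2 = ‖T‖ ^ 2 ∧
      ∀ χ : EuclideanSpace ℝ (Fin d) → ℂ, ContDiff ℝ ∞ χ → HasCompactSupport χ →
        ∫ x, (τ x : ℂ) * χ x = ∫ ξ, H ξ * ((2 * π * ‖ξ‖) ^ s : ℝ) * 𝓕 χ ξ := by
  obtain ⟨G, hG, hGn, hrep⟩ := exists_hermitian_representation T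
  have hp : (2 * π : ℝ) ≠ 0 := by positivity
  have hq := Measure.quasiMeasurePreserving_smul (volume : Measure (EuclideanSpace ℝ (Fin d))) hp
  let H : EuclideanSpace ℝ (Fin d) → ℂ := fun ξ =>
    ((2 * π) ^ ((d : ℝ) / 2) : ℝ) * conj (G ((2 * π) • ξ))
  have hGm : AEStronglyMeasurable (fun ξ => conj (G ((2 * π) • ξ))) volume :=
    Complex.continuous_conj.comp_aestronglyMeasurable
      ((Lp.aestronglyMeasurable G).comp_quasiMeasurePreserving hq)
  have hH : MemLp H 2 := by
    refine MemLp.const_mul ((memLp_two_iff_integrable_sq_norm hGm).mpr ?_) _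
    simp only [RCLike.norm_conj]
    exact ((memLp_two_iff_integrable_sq_norm (Lp.aestronglyMeasurable G)).mp
      (Lp.memLp G)).comp_smul hp
  obtain ⟨N, hN⟩ := exists_nat_gt (s + finrank ℝ (EuclideanSpace ℝ (Fin d)) / 2)
  have hv := integrable_norm_mul_rpow_mul_one_add_norm_pow_inv hH two_pi_pos.le hs hN
  refine ⟨H, hH, ?_, (integral_norm_sq_rescale G).trans (by rw [hGn]), fun χ hχ hχs =>
    integral_mul_eq_integral_mul_fourier_of_real ?_ ?_ hv
      (fun f hf hfs => hT.integral_mul_eq hs hrep hf hfs) hχ hχs⟩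
  · filter_upwards [hq.ae hG] with ξ hξ
    rw [← smul_neg] at hξ
    simp only [H, hξ, map_mul, Complex.conj_ofReal]
  · exact hτ.mono (Complex.continuous_ofReal.comp_aestronglyMeasurable hτ.aestronglyMeasurable)
      (.of_forall fun x => (Complex.norm_real _).le)
  · exact hH.1.mul (by fun_prop)

end FourierPairing

section GaussianPairing

theorem memLp_of_integrable_of_norm_le_one {X V : Type*} [MeasurableSpace X] {μ : Measure X}
    [NormedAddCommGroup V] {q : ℝ} (hq : 1 ≤ q) {g : X → V} (hg : Integrable g μ)
    (hg₁ : ∀ x, ‖g x‖ ≤ 1) : MemLp g (.ofReal q) μ := by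
  rw [← integrable_norm_rpow_iff hg.1 (by simpa using one_pos.trans_le hq) ENNReal.ofReal_ne_top,
    ENNReal.toReal_ofReal (zero_le_one.trans hq)]
  refine hg.norm.mono' (hg.1.norm.aemeasurable.pow_const q).aestronglyMeasurable
    (.of_forall fun x => ?_)
  rw [norm_of_nonneg (by positivity)]
  exact rpow_le_self_of_le_one (norm_nonneg _) (hg₁ x) hq

theorem integrable_mul_of_norm_le_one {X 𝕜 : Type*} [MeasurableSpace X] [RCLike 𝕜] {μ : Measure X}
    {q : ℝ} (hq : 1 ≤ q) {u g : X → 𝕜} (hu : MemLp u (.ofReal q) μ) (hg : Integrable g μ)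
    (hg₁ : ∀ x, ‖g x‖ ≤ 1) : Integrable (fun x => g x * u x) μ := by
  have hpow : Integrable (fun x => ‖u x‖ ^ q) μ := by
    simpa [ENNReal.toReal_ofReal (zero_le_one.trans hq)] using
      hu.integrable_norm_rpow (by simpa using one_pos.trans_le hq) ENNReal.ofReal_ne_top
  refine (hg.norm.add hpow).mono' (hg.1.mul hu.1) (.of_forall fun x => ?_)
  rw [norm_mul, Pi.add_apply]
  rcases le_total ‖u x‖ 1 with h | h
  · exact (mul_le_of_le_one_right (norm_nonneg _) h).trans
      (le_add_of_nonneg_right (by positivity))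
  · exact (mul_le_of_le_one_left (norm_nonneg _) (hg₁ x)).trans
      ((self_le_rpow_of_one_le h hq).trans (le_add_of_nonneg_left (norm_nonneg _)))

variable {E : Type*} [NormedAddCommGroup E]

theorem exists_one_add_norm_pow_mul_gaussianWeight_le {b : ℝ} (hb : 0 < b) (N : ℕ) :
    ∃ C, ∀ x : E, (1 + ‖x‖) ^ N * gaussianWeight b x ≤ C := by
  refine ⟨N.factorial * exp (1 + 1 / (4 * (π * b))), fun x => ?_⟩
  have hpb : 0 < π * b := by positivity
  have hpow : (1 + ‖x‖) ^ N ≤ N.factorial * exp (1 + ‖x‖) := by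
    rw [← div_le_iff₀' (by positivity)]
    exact pow_div_factorial_le_exp _ (by positivity) N
  have hsq : ‖x‖ - π * b * ‖x‖ ^ 2 ≤ 1 / (4 * (π * b)) := by
    rw [le_div_iff₀ (by positivity)]
    nlinarith [sq_nonneg (2 * (π * b) * ‖x‖ - 1)]
  calc (1 + ‖x‖) ^ N * gaussianWeight b x
      ≤ N.factorial * exp (1 + ‖x‖) * gaussianWeight b x :=
        mul_le_mul_of_nonneg_right hpow (gaussianWeight_pos b x).le
    _ = N.factorial * exp (1 + ‖x‖ + -(π * b) * ‖x‖ ^ 2) := by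
        rw [gaussianWeight, mul_assoc, ← exp_add]
    _ ≤ _ := mul_le_mul_of_nonneg_left (exp_le_exp.mpr (by linarith)) (by positivity)

variable [InnerProductSpace ℝ E]

theorem exists_one_add_norm_pow_mul_heatKernel_sub_le {a : ℝ} (ha : 0 < a) (N : ℕ) (η : E) :
    ∃ C, ∀ ξ : E, (1 + ‖ξ‖) ^ N * heatKernel a (ξ - η) ≤ C := by
  obtain ⟨C, hC⟩ := exists_one_add_norm_pow_mul_gaussianWeight_le (E := E) (inv_pos.mpr ha) N
  refine ⟨(1 + ‖η‖) ^ N * (a ^ (-(finrank ℝ E : ℝ) / 2) * C), fun ξ => ?_⟩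
  have hpeetre : 1 + ‖ξ‖ ≤ (1 + ‖η‖) * (1 + ‖ξ - η‖) := by
    nlinarith [norm_le_insert' ξ η, norm_nonneg η, norm_nonneg (ξ - η)]
  calc (1 + ‖ξ‖) ^ N * heatKernel a (ξ - η)
      ≤ ((1 + ‖η‖) * (1 + ‖ξ - η‖)) ^ N * heatKernel a (ξ - η) := by
        have := heatKernel_pos ha (ξ - η)
        gcongr
    _ = (1 + ‖η‖) ^ N * (a ^ (-(finrank ℝ E : ℝ) / 2) *
          ((1 + ‖ξ - η‖) ^ N * gaussianWeight a⁻¹ (ξ - η))) := by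
        rw [mul_pow, heatKernel]
        ring
    _ ≤ _ := by
        gcongr
        exact hC _

variable [FiniteDimensional ℝ E] [MeasurableSpace E] [BorelSpace E] {N : ℕ} {q a b : ℝ}
  {u v : E → ℂ}

namespace IsDistributionalFourier

theorem integral_eq_of_norm_eq_gaussianWeight (huv : IsDistributionalFourier N u v) (hq : 1 ≤ q)
    (hu : MemLp u (.ofReal q)) (hb : 0 < b) (x : E) {φ : E → ℂ} (hφ : ContDiff ℝ ∞ φ)
    (hφn : ∀ y, ‖φ y‖ = gaussianWeight b (y - x)) {C : ℝ}
    (hC : ∀ ξ, (1 + ‖ξ‖) ^ N * ‖𝓕 φ ξ‖ ≤ C) :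
    ∫ y, u y * φ y = ∫ ξ, v ξ * 𝓕 φ ξ := by
  have hφi : Integrable φ := ((integrable_gaussianWeight hb).comp_sub_right x).mono'
    hφ.continuous.aestronglyMeasurable (.of_forall fun y => (hφn y).le)
  refine huv.integral_eq_of_decay hφ hφi ?_ hC
  refine (integrable_mul_of_norm_le_one hq hu hφi fun y => ?_).congr
    (.of_forall fun y => mul_comm _ _)
  exact (hφn y).trans_le (gaussianWeight_le_one hb.le _)

theorem integral_mul_translated_gaussianWeight (huv : IsDistributionalFourier N u v) (hq : 1 ≤ q)
    (hu : MemLp u (.ofReal q)) (hb : 0 < b) (x : E) :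
    ∫ y, u y * gaussianWeight b (y - x) =
      ∫ ξ, v (-ξ) * (Complex.exp (↑(2 * π * ⟪x, ξ⟫) * Complex.I) * heatKernel b ξ) := by
  obtain ⟨C, hC⟩ := exists_one_add_norm_pow_mul_heatKernel_sub_le hb N (0 : E)
  have h := huv.integral_eq_of_norm_eq_gaussianWeight hq hu hb x (C := C)
    (φ := fun y => gaussianWeight b (y - x))
    (Complex.ofRealCLM.contDiff.comp
      (contDiff_gaussianWeight.comp (contDiff_id.sub contDiff_const)))
    (fun y => by rw [Complex.norm_real, norm_of_nonneg (gaussianWeight_pos b _).le])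
    (fun ξ => by
      rw [fourier_translated_gaussianWeight hb, norm_mul, Complex.norm_exp_ofReal_mul_I, one_mul,
        Complex.norm_real, norm_of_nonneg (heatKernel_pos hb ξ).le]
      simpa only [sub_zero] using hC ξ)
  rw [h, ← integral_neg_eq_self]
  simp only [fourier_translated_gaussianWeight hb, inner_neg_right, heatKernel_neg, mul_neg,
    neg_mul, neg_neg]

theorem integral_mul_modulated_gaussianWeight (huv : IsDistributionalFourier N u v) (hq : 1 ≤ q)
    (hu : MemLp u (.ofReal q)) (ha : 0 < a) (η : E) :
    ∫ x, u x * (Complex.exp (↑(2 * π * ⟪x, η⟫) * Complex.I) * gaussianWeight a x) =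
      ∫ ξ, v ξ * heatKernel a (ξ - η) := by
  obtain ⟨C, hC⟩ := exists_one_add_norm_pow_mul_heatKernel_sub_le ha N η
  have hphase : ContDiff ℝ ∞ fun x : E => Complex.exp (↑(2 * π * ⟪x, η⟫) * Complex.I) :=
    ((Complex.ofRealCLM.contDiff.comp (contDiff_const.mul (contDiff_id.inner ℝ contDiff_const))).mul
      contDiff_const).cexp
  have h := huv.integral_eq_of_norm_eq_gaussianWeight hq hu ha 0 (C := C)
    (φ := fun x => Complex.exp (↑(2 * π * ⟪x, η⟫) * Complex.I) * gaussianWeight a x)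
    (hphase.mul (Complex.ofRealCLM.contDiff.comp contDiff_gaussianWeight))
    (fun x => by
      rw [norm_mul, Complex.norm_exp_ofReal_mul_I, one_mul, Complex.norm_real, sub_zero,
        norm_of_nonneg (gaussianWeight_pos a x).le])
    (fun ξ => by
      rw [fourier_modulated_gaussianWeight ha, Complex.norm_real,
        norm_of_nonneg (heatKernel_pos ha _).le]
      exact hC ξ)
  simpa only [fourier_modulated_gaussianWeight ha] using h

theorem integral_gaussianWeight_energy (huv : IsDistributionalFourier N u v) (hq : 1 ≤ q)
    (hu : MemLp u (.ofReal q)) (ha : 0 < a) (hb : 0 < b) :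
    ∫ x, u x * gaussianWeight a x * ∫ y, u y * gaussianWeight b (y - x) =
      ∫ η, v (-η) * heatKernel b η * ∫ ξ, v ξ * heatKernel a (ξ - η) := by
  have hF : Integrable fun x => u x * (gaussianWeight a x : ℂ) :=
    (integrable_mul_of_norm_le_one hq hu (g := fun x => (gaussianWeight a x : ℂ))
      (integrable_gaussianWeight ha).ofReal fun x => by
        rw [Complex.norm_real, norm_of_nonneg (gaussianWeight_pos a x).le]
        exact gaussianWeight_le_one ha.le x).congr (.of_forall fun x => mul_comm _ _)
  have hG : Integrable fun η => v (-η) * (heatKernel b η : ℂ) := by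
    obtain ⟨C, hC⟩ := exists_one_add_norm_pow_mul_heatKernel_sub_le hb N (0 : E)
    have h := integrable_mul_of_decay huv.aestronglyMeasurable huv.integrable
      (Complex.continuous_ofReal.comp (continuous_heatKernel)).aestronglyMeasurable (C := C)
      fun ξ => by
        rw [Function.comp_apply, Complex.norm_real, norm_of_nonneg (heatKernel_pos hb ξ).le]
        simpa only [sub_zero] using hC ξ
    exact h.comp_neg.congr (.of_forall fun η => by simp only [Function.comp_apply, heatKernel_neg])
  have hFG : Integrable (Function.uncurry fun x η : E =>
      Complex.exp (↑(2 * π * ⟪x, η⟫) * Complex.I) *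
        (u x * gaussianWeight a x * (v (-η) * heatKernel b η))) := by
    refine (hF.mul_prod hG).bdd_mul (c := 1) (Continuous.aestronglyMeasurable (by fun_prop))
      (.of_forall fun z => (Complex.norm_exp_ofReal_mul_I _).le)
  simp only [huv.integral_mul_translated_gaussianWeight hq hu hb,
    ← huv.integral_mul_modulated_gaussianWeight hq hu ha, ← integral_const_mul]
  calc _ = ∫ x, ∫ η, Complex.exp (↑(2 * π * ⟪x, η⟫) * Complex.I) *
          (u x * gaussianWeight a x * (v (-η) * heatKernel b η)) := by
        refine integral_congr_ae (.of_forall fun x => integral_congr_ae (.of_forall fun η => ?_))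
        ring
    _ = _ := by
        rw [integral_integral_swap hFG]
        refine integral_congr_ae (.of_forall fun η => integral_congr_ae (.of_forall fun x => ?_))
        ring

end IsDistributionalFourier

end GaussianPairing

section HeatDefect

theorem integral_smul_mul_le_sqrt_mul_sqrt {Z : Type*} [MeasurableSpace Z] {μ : Measure Z}
    {κ : Z → ℝ} (hκ : AEStronglyMeasurable κ μ) (hκ₀ : ∀ z, 0 ≤ κ z) {F G : Z → ℂ}
    (hF : AEStronglyMeasurable F μ) (hG : AEStronglyMeasurable G μ)
    (hFi : Integrable (fun z => κ z * ‖F z‖ ^ 2) μ)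
    (hGi : Integrable (fun z => κ z * ‖G z‖ ^ 2) μ) :
    Integrable (fun z => κ z • (F z * G z)) μ ∧
      ‖∫ z, κ z • (F z * G z) ∂μ‖ ≤
        √(∫ z, κ z * ‖F z‖ ^ 2 ∂μ) * √(∫ z, κ z * ‖G z‖ ^ 2 ∂μ) := by
  have hsqrt : AEStronglyMeasurable (fun z => √(κ z)) μ :=
    continuous_sqrt.comp_aestronglyMeasurable hκ
  have hnorm : ∀ {K : Z → ℂ} (z : Z), ‖√(κ z) • K z‖ ^ 2 = κ z * ‖K z‖ ^ 2 := fun z => by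
    rw [norm_smul, mul_pow, norm_of_nonneg (sqrt_nonneg _), sq_sqrt (hκ₀ z)]
  have hmemLp : ∀ {K : Z → ℂ}, AEStronglyMeasurable K μ →
      Integrable (fun z => κ z * ‖K z‖ ^ 2) μ → MemLp (fun z => √(κ z) • K z) 2 μ := fun hK hKi =>
    (memLp_two_iff_integrable_sq_norm (hsqrt.smul hK)).mpr
      (hKi.congr (.of_forall fun z => (hnorm z).symm))
  have hmul : ∀ z, κ z • (F z * G z) = (√(κ z) • F z) * (√(κ z) • G z) := fun z => by
    rw [smul_mul_smul_comm, mul_self_sqrt (hκ₀ z)]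
  have hcs := integral_mul_norm_le_Lp_mul_Lq (μ := μ) HolderConjugate.two_two
    (f := fun z => √(κ z) • F z) (g := fun z => √(κ z) • G z)
    (by simpa using hmemLp hF hFi) (by simpa using hmemLp hG hGi)
  simp only [rpow_two, hnorm, ← sqrt_eq_rpow] at hcs
  refine ⟨((hmemLp hF hFi).integrable_mul (hmemLp hG hGi)).congr
    (.of_forall fun z => (hmul z).symm), (norm_integral_le_integral_norm _).trans ?_⟩
  simpa only [hmul, norm_mul] using hcs

variable {E : Type*} [NormedAddCommGroup E] [InnerProductSpace ℝ E] {s a : ℝ} {ξ : E}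

theorem heatKernel_mul_sq_sub_one (η : E) :
    heatKernel a (ξ - η) * (‖ξ‖ ^ s * ‖η‖ ^ (-s) - 1) ^ 2 =
      ‖ξ‖ ^ (2 * s) * (‖η‖ ^ (-(2 * s)) * heatKernel a (ξ - η)) -
        2 * (‖ξ‖ ^ s * (‖η‖ ^ (-s) * heatKernel a (ξ - η))) + heatKernel a (ξ - η) := by
  have hsq : ∀ (t : ℝ) (x : E), ‖x‖ ^ (2 * t) = (‖x‖ ^ t) ^ 2 := fun t x => by
    rw [mul_comm, ← rpow_mul_natCast (norm_nonneg x) t 2, Nat.cast_ofNat]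
  rw [hsq, show -(2 * s) = 2 * -s by ring, hsq]
  ring

variable [FiniteDimensional ℝ E] [MeasurableSpace E] [BorelSpace E]

/-- The mean square deviation of `(‖ξ‖ / ‖η‖) ^ s` from `1` when `η` is distributed according to
the heat kernel centred at `ξ`. -/
noncomputable def heatDefect (s a : ℝ) (ξ : E) : ℝ :=
  ∫ η, heatKernel a (ξ - η) * (‖ξ‖ ^ s * ‖η‖ ^ (-s) - 1) ^ 2

theorem integrable_heatKernel_mul_sq_sub_one (hs : 0 < s) (hsn : 2 * s < finrank ℝ E) (ha : 0 < a)
    (hξ : ξ ≠ 0) :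
    Integrable (fun η : E => heatKernel a (ξ - η) * (‖ξ‖ ^ s * ‖η‖ ^ (-s) - 1) ^ 2) := by
  simp only [heatKernel_mul_sq_sub_one]
  exact (((integral_norm_rpow_mul_heatKernel_sub (by linarith) hsn ha hξ).1.const_mul _).sub
    (((integral_norm_rpow_mul_heatKernel_sub hs (by linarith) ha hξ).1.const_mul _).const_mul
      2)).add ((integrable_heatKernel ha).comp_sub_left ξ)

theorem heatDefect_eq (hs : 0 < s) (hsn : 2 * s < finrank ℝ E) (ha : 0 < a) (hξ : ξ ≠ 0) :
    heatDefect s a ξ = heatAverage (2 * s) a ξ - 2 * heatAverage s a ξ + 1 := by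
  have h₂ := (integral_norm_rpow_mul_heatKernel_sub (E := E) (β := 2 * s) (by linarith) hsn ha
    hξ).1.const_mul (‖ξ‖ ^ (2 * s))
  have h₁ := ((integral_norm_rpow_mul_heatKernel_sub (E := E) hs (by linarith) ha hξ).1.const_mul
    (‖ξ‖ ^ s)).const_mul 2
  simp only [heatDefect, heatKernel_mul_sq_sub_one]
  refine (integral_add (h₂.sub h₁) ((integrable_heatKernel ha).comp_sub_left ξ)).trans ?_
  rw [integral_sub' h₂ h₁, integral_const_mul, integral_const_mul, integral_const_mul,
    integral_sub_left_eq_self (heatKernel a), integral_heatKernel ha]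
  rfl

theorem heatDefect_nonneg (ha : 0 < a) (ξ : E) : 0 ≤ heatDefect s a ξ :=
  integral_nonneg fun _ => mul_nonneg (heatKernel_pos ha _).le (sq_nonneg _)

theorem measurable_heatKernel_mul_sq_sub_one :
    Measurable fun z : E × E =>
      heatKernel a (z.1 - z.2) * (‖z.1‖ ^ s * ‖z.2‖ ^ (-s) - 1) ^ 2 :=
  (continuous_heatKernel.comp (continuous_fst.sub continuous_snd)).measurable.mul (by fun_prop)

theorem measurable_heatDefect : Measurable (heatDefect (E := E) s a) :=
  measurable_heatKernel_mul_sq_sub_one.stronglyMeasurable.integral_prod_right.measurable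

theorem tendsto_heatDefect (hs : 0 < s) (hsn : 2 * s < finrank ℝ E) (hξ : ξ ≠ 0) :
    Tendsto (fun a => heatDefect s a ξ) (𝓝[>] 0) (𝓝 0) := by
  have h := ((tendsto_heatAverage (by linarith) hsn hξ).sub
    ((tendsto_heatAverage hs (by linarith) hξ).const_mul 2)).add_const 1
  refine (h.congr' (eventually_mem_nhdsWithin.mono fun a (ha : 0 < a) =>
    (heatDefect_eq hs hsn ha hξ).symm)).trans_eq ?_
  norm_num

theorem exists_heatDefect_le (hs : 0 < s) (hsn : 2 * s < finrank ℝ E) :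
    ∃ C, ∀ a, 0 < a → ∀ ξ : E, ξ ≠ 0 → heatDefect s a ξ ≤ C := by
  obtain ⟨C, hC⟩ := exists_heatAverage_le (E := E) (β := 2 * s) (by linarith) hsn
  refine ⟨C + 1, fun a ha ξ hξ => ?_⟩
  have hnonneg : 0 ≤ heatAverage s a ξ := mul_nonneg (by positivity)
    (integral_nonneg fun _ => mul_nonneg (by positivity) (heatKernel_pos ha _).le)
  rw [heatDefect_eq hs hsn ha hξ]
  linarith [hC a ha ξ]

theorem ae_ne_zero_of_pos_finrank (hn : 0 < (finrank ℝ E : ℝ)) : ∀ᵐ ξ : E, ξ ≠ 0 :=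
  have : Nontrivial E := nontrivial_of_finrank_pos (R := ℝ) (by exact_mod_cast hn)
  Measure.ae_ne volume 0

theorem integrable_heatDefect_mul_norm_sq (hs : 0 < s) (hsn : 2 * s < finrank ℝ E) (ha : 0 < a)
    {f : E → ℂ} (hf : MemLp f 2) : Integrable (fun ξ => heatDefect s a ξ * ‖f ξ‖ ^ 2) := by
  obtain ⟨C, hC⟩ := exists_heatDefect_le (E := E) hs hsn
  refine hf.integrable_norm_pow two_ne_zero |>.bdd_mul (c := C)
    measurable_heatDefect.aestronglyMeasurable ?_
  filter_upwards [ae_ne_zero_of_pos_finrank (by linarith)] with ξ hξ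
  rw [norm_of_nonneg (heatDefect_nonneg ha ξ)]
  exact hC a ha ξ hξ

theorem tendsto_integral_heatDefect_mul_norm_sq (hs : 0 < s) (hsn : 2 * s < finrank ℝ E)
    {f : E → ℂ} (hf : MemLp f 2) :
    Tendsto (fun a => ∫ ξ, heatDefect s a ξ * ‖f ξ‖ ^ 2) (𝓝[>] 0) (𝓝 0) := by
  obtain ⟨C, hC⟩ := exists_heatDefect_le (E := E) hs hsn
  have hne : ∀ᵐ ξ : E, ξ ≠ 0 := ae_ne_zero_of_pos_finrank (by linarith)
  rw [show 𝓝 (0 : ℝ) = 𝓝 (∫ _ : E, (0 : ℝ)) by rw [integral_zero]]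
  refine tendsto_integral_filter_of_dominated_convergence (fun ξ => C * ‖f ξ‖ ^ 2)
    (eventually_mem_nhdsWithin.mono fun a ha => (integrable_heatDefect_mul_norm_sq hs hsn ha hf).1)
    (eventually_mem_nhdsWithin.mono fun a (ha : 0 < a) => ?_)
    ((hf.integrable_norm_pow two_ne_zero).const_mul C) ?_
  · filter_upwards [hne] with ξ hξ
    rw [norm_of_nonneg (mul_nonneg (heatDefect_nonneg ha ξ) (sq_nonneg _))]
    exact mul_le_mul_of_nonneg_right (hC a ha ξ hξ) (sq_nonneg _)
  · filter_upwards [hne] with ξ hξ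
    simpa only [zero_mul] using (tendsto_heatDefect hs hsn hξ).mul_const (‖f ξ‖ ^ 2)

theorem integral_prod_heatKernel_mul_sq_sub_one (hs : 0 < s) (hsn : 2 * s < finrank ℝ E)
    (ha : 0 < a) {f : E → ℂ} (hf : MemLp f 2) :
    Integrable (fun z : E × E =>
      heatKernel a (z.1 - z.2) * (‖z.1‖ ^ s * ‖z.2‖ ^ (-s) - 1) ^ 2 * ‖f z.1‖ ^ 2) ∧
    ∫ z : E × E, heatKernel a (z.1 - z.2) * (‖z.1‖ ^ s * ‖z.2‖ ^ (-s) - 1) ^ 2 * ‖f z.1‖ ^ 2 =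
      ∫ ξ, heatDefect s a ξ * ‖f ξ‖ ^ 2 := by
  have h := integrable_prod_smul (μ := (volume : Measure E)) (ν := volume)
    (F := fun ξ => ‖f ξ‖ ^ 2) (κ := fun ξ η =>
      heatKernel a (ξ - η) * (‖ξ‖ ^ s * ‖η‖ ^ (-s) - 1) ^ 2) (hf.1.norm.pow 2)
    measurable_heatKernel_mul_sq_sub_one
    (.of_forall fun ξ => .of_forall fun η => mul_nonneg (heatKernel_pos ha _).le (sq_nonneg _))
    ((ae_ne_zero_of_pos_finrank (by linarith)).mono fun ξ hξ =>
      integrable_heatKernel_mul_sq_sub_one hs hsn ha hξ)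
    (integrable_heatDefect_mul_norm_sq hs hsn ha hf)
  refine ⟨h, (integral_prod _ h).trans ?_⟩
  simp only [smul_eq_mul, integral_mul_const, heatDefect]

theorem integral_prod_heatKernel_mul (ha : 0 < a) {g : E → ℂ} (hg : MemLp g 2) :
    Integrable (fun z : E × E => heatKernel a (z.1 - z.2) * ‖g z.2‖ ^ 2) ∧
    ∫ z : E × E, heatKernel a (z.1 - z.2) * ‖g z.2‖ ^ 2 = ∫ η, ‖g η‖ ^ 2 := by
  have h : Integrable (fun z : E × E => heatKernel a (z.1 - z.2) * ‖g z.2‖ ^ 2) :=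
    (hg.integrable_norm_pow two_ne_zero).convolution_integrand (ContinuousLinearMap.mul ℝ ℝ)
      (integrable_heatKernel ha) |>.congr (.of_forall fun z => mul_comm _ _)
  refine ⟨h, (integral_prod_symm _ h).trans ?_⟩
  simp only [integral_mul_const, integral_sub_right_eq_self, integral_heatKernel ha, one_mul]

theorem integral_prod_heatKernel_smul_sub_one_le (hs : 0 < s) (hsn : 2 * s < finrank ℝ E)
    (ha : 0 < a) {f g : E → ℂ} (hf : MemLp f 2) (hg : MemLp g 2) :
    Integrable (fun z : E × E =>
      heatKernel a (z.1 - z.2) • ((‖z.1‖ ^ s * ‖z.2‖ ^ (-s) - 1) • f z.1 * g z.2)) ∧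
    ‖∫ z : E × E, heatKernel a (z.1 - z.2) • ((‖z.1‖ ^ s * ‖z.2‖ ^ (-s) - 1) • f z.1 * g z.2)‖ ≤
      √(∫ ξ, heatDefect s a ξ * ‖f ξ‖ ^ 2) * √(∫ η, ‖g η‖ ^ 2) := by
  have hdefect := integral_prod_heatKernel_mul_sq_sub_one hs hsn ha hf
  have hmass := integral_prod_heatKernel_mul ha hg
  have hnorm : ∀ z : E × E,
      heatKernel a (z.1 - z.2) * ‖(‖z.1‖ ^ s * ‖z.2‖ ^ (-s) - 1) • f z.1‖ ^ 2 =
        heatKernel a (z.1 - z.2) * (‖z.1‖ ^ s * ‖z.2‖ ^ (-s) - 1) ^ 2 * ‖f z.1‖ ^ 2 := fun z => by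
    rw [norm_smul, mul_pow, norm_eq_abs, sq_abs, mul_assoc]
  simp only [← hdefect.2, ← hmass.2, ← hnorm]
  refine integral_smul_mul_le_sqrt_mul_sqrt (κ := fun z : E × E => heatKernel a (z.1 - z.2))
    (F := fun z => (‖z.1‖ ^ s * ‖z.2‖ ^ (-s) - 1) • f z.1)
    (continuous_heatKernel.comp (continuous_fst.sub continuous_snd)).aestronglyMeasurable
    (fun z => (heatKernel_pos ha _).le) ?_ hg.1.comp_snd ?_ hmass.1
  · have hm : Measurable fun z : E × E => ‖z.1‖ ^ s * ‖z.2‖ ^ (-s) - 1 := by fun_prop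
    exact hm.aestronglyMeasurable.smul hf.1.comp_fst
  · simpa only [hnorm] using hdefect.1

end HeatDefect

section HeatForm

variable {E : Type*} [NormedAddCommGroup E] [InnerProductSpace ℝ E] {s a : ℝ} {f g : E → ℂ}

theorem heatKernel_smul_rpow_smul_mul (z : E × E) :
    (heatKernel a (z.1 - z.2) * (‖z.1‖ ^ s * ‖z.2‖ ^ (-s))) • (f z.1 * g z.2) =
      heatKernel a (z.1 - z.2) • ((‖z.1‖ ^ s * ‖z.2‖ ^ (-s) - 1) • f z.1 * g z.2) +
        heatKernel a (z.1 - z.2) • (f z.1 * g z.2) := by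
  rw [← smul_add, smul_mul_assoc, sub_smul, one_smul, sub_add_cancel, mul_smul]

variable [FiniteDimensional ℝ E] [MeasurableSpace E] [BorelSpace E]

theorem integral_comp_add_mul_eq_inner (hf : MemLp f 2) (hg : MemLp g 2) (w : E) :
    ∫ η, f (w + η) * g η = inner ℂ hg.star.toLp (DomAddAct.mk w +ᵥ hf.toLp f) := by
  rw [L2.inner_def]
  refine integral_congr_ae ?_
  have htranslate := (hf.comp_measurePreserving (measurePreserving_vadd w volume)).coeFn_toLp
  simp only [Function.comp_def] at htranslate
  filter_upwards [hg.star.coeFn_toLp, htranslate] with η h₁ h₂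
  rw [DomAddAct.mk_vadd_toLp, h₁, h₂]
  simp [mul_comm]

theorem continuous_integral_comp_add_mul (hf : MemLp f 2) (hg : MemLp g 2) :
    Continuous fun w => ∫ η, f (w + η) * g η := by
  have : Fact ((2 : ℝ≥0∞) ≠ ⊤) := ⟨by simp⟩
  simp only [integral_comp_add_mul_eq_inner hf hg]
  exact continuous_const.inner (DomAddAct.continuous_mk.vadd continuous_const)

theorem norm_integral_comp_add_mul_le (hf : MemLp f 2) (hg : MemLp g 2) (w : E) :
    ‖∫ η, f (w + η) * g η‖ ≤ ‖hg.star.toLp‖ * ‖hf.toLp f‖ := by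
  rw [integral_comp_add_mul_eq_inner hf hg]
  exact (norm_inner_le_norm _ _).trans_eq (by rw [DomAddAct.norm_vadd_Lp])

theorem integrable_heatKernel_smul_mul (ha : 0 < a) (hf : MemLp f 2) (hg : MemLp g 2) :
    Integrable (fun z : E × E => heatKernel a (z.1 - z.2) • (f z.1 * g z.2)) :=
  (integral_smul_mul_le_sqrt_mul_sqrt (κ := fun z : E × E => heatKernel a (z.1 - z.2))
    (continuous_heatKernel.comp (continuous_fst.sub continuous_snd)).aestronglyMeasurable
    (fun z => (heatKernel_pos ha _).le) hf.1.comp_fst hg.1.comp_snd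
    ((integral_prod_heatKernel_mul ha hf).1.swap.congr (.of_forall fun z => by
      simp only [Function.comp_apply, Prod.fst_swap, Prod.snd_swap]
      rw [← heatKernel_neg, neg_sub]))
    (integral_prod_heatKernel_mul ha hg).1).1

theorem integral_heatKernel_smul_mul (ha : 0 < a) (hf : MemLp f 2) (hg : MemLp g 2) :
    ∫ z : E × E, heatKernel a (z.1 - z.2) • (f z.1 * g z.2) =
      ∫ w, heatKernel 1 w • ∫ η, f (√a • w + η) * g η := by
  have hi := integrable_heatKernel_smul_mul ha hf hg
  have hshear : Integrable (fun z : E × E => heatKernel a z.1 • (f (z.1 + z.2) * g z.2)) :=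
    ((measurePreserving_add_prod volume volume).integrable_comp_of_integrable hi).congr
      (.of_forall fun z => by simp)
  have hscale := Measure.integral_comp_smul (volume : Measure E)
    (fun w => heatKernel a w • ∫ η, f (w + η) * g η) √a
  have hpow : √a ^ finrank ℝ E = a ^ ((finrank ℝ E : ℝ) / 2) := by
    rw [sqrt_eq_rpow, ← rpow_mul_natCast ha.le]
    ring_nf
  calc ∫ z : E × E, heatKernel a (z.1 - z.2) • (f z.1 * g z.2)
      = ∫ η, ∫ w, heatKernel a w • (f (w + η) * g η) := by
        refine (integral_prod_symm _ hi).trans (integral_congr_ae (.of_forall fun η => ?_))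
        beta_reduce
        rw [← integral_add_right_eq_self _ η]
        simp only [add_sub_cancel_right]
    _ = ∫ w, heatKernel a w • ∫ η, f (w + η) * g η := by
        rw [← integral_integral_swap hshear]
        simp only [integral_smul]
    _ = _ := by
        simp only [heatKernel_sqrt_smul ha, mul_smul] at hscale
        rw [integral_smul, hpow, abs_of_pos (by positivity), ← rpow_neg ha.le, ← neg_div] at hscale
        exact (smul_right_injective _ (by positivity) hscale).symm

theorem tendsto_integral_heatKernel_smul_mul (hf : MemLp f 2) (hg : MemLp g 2) :
    Tendsto (fun a => ∫ z : E × E, heatKernel a (z.1 - z.2) • (f z.1 * g z.2)) (𝓝[>] 0)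
      (𝓝 (∫ ξ, f ξ * g ξ)) := by
  have hρ := continuous_integral_comp_add_mul hf hg
  have hlim : ∫ w, heatKernel (E := E) 1 w • ∫ η, f (0 + η) * g η = ∫ ξ, f ξ * g ξ := by
    simp only [zero_add]
    rw [integral_smul_const, integral_heatKernel one_pos, one_smul]
  rw [← hlim]
  refine Tendsto.congr' (eventually_mem_nhdsWithin.mono fun a ha =>
    (integral_heatKernel_smul_mul ha hf hg).symm) ?_
  refine tendsto_integral_filter_of_dominated_convergence
    (fun w => heatKernel 1 w * (‖hg.star.toLp‖ * ‖hf.toLp f‖))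
    (.of_forall fun a => (continuous_heatKernel.smul
      (hρ.comp (continuous_const_smul _))).aestronglyMeasurable)
    (.of_forall fun a => .of_forall fun w => ?_)
    ((integrable_heatKernel one_pos).mul_const _) (.of_forall fun w => ?_)
  · rw [norm_smul, norm_of_nonneg (heatKernel_pos one_pos w).le]
    exact mul_le_mul_of_nonneg_left (norm_integral_comp_add_mul_le hf hg _)
      (heatKernel_pos one_pos w).le
  · have hsqrt : Tendsto (fun a : ℝ => √a • w) (𝓝[>] 0) (𝓝 0) :=
      ((continuous_sqrt.smul continuous_const).tendsto' 0 0 (by simp)).mono_left nhdsWithin_le_nhds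
    exact ((hρ.tendsto 0).comp hsqrt).const_smul _

theorem integrable_heatKernel_mul_rpow_smul_mul (hs : 0 < s) (hsn : 2 * s < finrank ℝ E)
    (ha : 0 < a) (hf : MemLp f 2) (hg : MemLp g 2) :
    Integrable (fun z : E × E =>
      (heatKernel a (z.1 - z.2) * (‖z.1‖ ^ s * ‖z.2‖ ^ (-s))) • (f z.1 * g z.2)) := by
  simp only [heatKernel_smul_rpow_smul_mul]
  exact (integral_prod_heatKernel_smul_sub_one_le hs hsn ha hf hg).1.add
    (integrable_heatKernel_smul_mul ha hf hg)

theorem tendsto_integral_heatKernel_mul_rpow_smul_mul (hs : 0 < s) (hsn : 2 * s < finrank ℝ E)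
    (hf : MemLp f 2) (hg : MemLp g 2) :
    Tendsto (fun a => ∫ z : E × E,
      (heatKernel a (z.1 - z.2) * (‖z.1‖ ^ s * ‖z.2‖ ^ (-s))) • (f z.1 * g z.2)) (𝓝[>] 0)
      (𝓝 (∫ ξ, f ξ * g ξ)) := by
  have hdefect : Tendsto (fun a => ∫ z : E × E,
      heatKernel a (z.1 - z.2) • ((‖z.1‖ ^ s * ‖z.2‖ ^ (-s) - 1) • f z.1 * g z.2))
      (𝓝[>] 0) (𝓝 0) := by
    refine squeeze_zero_norm' (eventually_mem_nhdsWithin.mono fun a ha =>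
      (integral_prod_heatKernel_smul_sub_one_le hs hsn ha hf hg).2) ?_
    simpa using (tendsto_integral_heatDefect_mul_norm_sq hs hsn hf).sqrt.mul_const _
  rw [← zero_add (∫ ξ, f ξ * g ξ)]
  refine (hdefect.add (tendsto_integral_heatKernel_smul_mul hf hg)).congr'
    (eventually_mem_nhdsWithin.mono fun a ha => ?_)
  simp only [heatKernel_smul_rpow_smul_mul]
  exact (integral_add (integral_prod_heatKernel_smul_sub_one_le hs hsn ha hf hg).1
    (integrable_heatKernel_smul_mul ha hf hg)).symm

end HeatForm

section RieszEnergy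

variable {E : Type*} [NormedAddCommGroup E] [InnerProductSpace ℝ E] {α s a : ℝ} {F : E × E → ℂ}

theorem norm_rpow_smul_mul_rpow_norm_mul (hs : 0 < s) (H : E → ℂ) (ξ η : E) :
    ‖η‖ ^ (-(2 * s)) • (H (-η) * ((2 * π * ‖-η‖) ^ s : ℝ) *
        (H ξ * ((2 * π * ‖ξ‖) ^ s : ℝ) * heatKernel a (ξ - η))) =
      (2 * π) ^ (2 * s) •
        ((heatKernel a (ξ - η) * (‖ξ‖ ^ s * ‖η‖ ^ (-s))) • (H ξ * H (-η))) := by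
  have hη : ‖η‖ ^ (-(2 * s)) * ‖η‖ ^ s = ‖η‖ ^ (-s) := by
    rcases (norm_nonneg η).eq_or_lt with h | h
    · rw [← h, zero_rpow hs.ne', zero_rpow (neg_ne_zero.mpr hs.ne'), mul_zero]
    · rw [← rpow_add h]
      ring_nf
  have hπ : (2 * π) ^ (2 * s) = (2 * π) ^ s * (2 * π) ^ s := by
    rw [← rpow_add two_pi_pos, ← two_mul]
  rw [norm_neg, mul_rpow two_pi_pos.le (norm_nonneg _), mul_rpow two_pi_pos.le (norm_nonneg _), hπ,
    ← hη]
  simp only [Complex.real_smul]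
  push_cast
  ring

variable [FiniteDimensional ℝ E] [MeasurableSpace E] [BorelSpace E]

theorem integral_rpow_smul_integral_gaussianWeight_smul (hα : α < finrank ℝ E)
    (hn : 0 < (finrank ℝ E : ℝ)) (hF : AEStronglyMeasurable F)
    (h : Integrable fun z => ‖z.1 - z.2‖ ^ (α - finrank ℝ E) • F z) :
    ∫ b in Ioi (0 : ℝ), b ^ ((finrank ℝ E - α) / 2 - 1) •
        ∫ x, ∫ y, gaussianWeight b (x - y) • F (x, y) =
      (π ^ (-((finrank ℝ E - α) / 2)) * Gamma ((finrank ℝ E - α) / 2)) •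
        ∫ z, ‖z.1 - z.2‖ ^ (α - finrank ℝ E) • F z := by
  set p := (finrank ℝ E - α) / 2 with hp_def
  have hp : 0 < p := by linarith
  have hne : ∀ᵐ z : E × E, z.1 - z.2 ≠ 0 :=
    (quasiMeasurePreserving_sub_of_right_invariant volume volume).ae (ae_ne_zero_of_pos_finrank hn)
  have hκF : (fun z : E × E => (∫ b in Ioi (0 : ℝ),
      b ^ (p - 1) * gaussianWeight b (z.1 - z.2)) • F z) =ᵐ[volume]
        fun z => (π ^ (-p) * Gamma p) • ‖z.1 - z.2‖ ^ (α - finrank ℝ E) • F z :=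
    hne.mono fun z hz => by
      simp only [integral_rpow_mul_gaussianWeight hp hz, mul_smul]
      rw [show -(2 * p) = α - finrank ℝ E by rw [hp_def]; ring]
  rw [← integral_smul, ← integral_congr_ae hκF, Measure.volume_eq_prod,
    ← integral_integral_integral_smul hF ?_ ?_ ?_ ((h.fun_smul _).congr hκF.symm)]
  · simp only [← integral_smul, smul_smul]
  · simp only [gaussianWeight, Function.uncurry_def]
    fun_prop
  · exact .of_forall fun z => ae_restrict_of_forall_mem measurableSet_Ioi fun b (hb : 0 < b) =>
      mul_nonneg (rpow_nonneg hb.le _) (gaussianWeight_pos b _).le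
  · exact hne.mono fun z hz => integrableOn_rpow_mul_gaussianWeight hp hz

theorem integral_rpow_smul_integral_heatKernel_smul (hα : 0 < α) (hn : 0 < (finrank ℝ E : ℝ))
    (hF : AEStronglyMeasurable F) (h : Integrable fun z => ‖z.1‖ ^ (-α) • F z) :
    ∫ b in Ioi (0 : ℝ), b ^ ((finrank ℝ E - α) / 2 - 1) •
        ∫ η, ∫ ξ, heatKernel b η • F (η, ξ) =
      (π ^ (-(α / 2)) * Gamma (α / 2)) • ∫ z, ‖z.1‖ ^ (-α) • F z := by
  have hne : ∀ᵐ z : E × E, z.1 ≠ 0 :=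
    Measure.quasiMeasurePreserving_fst.ae (ae_ne_zero_of_pos_finrank hn)
  have hκF : (fun z : E × E => (∫ b in Ioi (0 : ℝ),
      b ^ ((finrank ℝ E - α) / 2 - 1) * heatKernel b z.1) • F z) =ᵐ[volume]
        fun z => (π ^ (-(α / 2)) * Gamma (α / 2)) • (‖z.1‖ ^ (-α) • F z) :=
    hne.mono fun z hz => by simp only [integral_rpow_mul_heatKernel hα hz, mul_smul]
  rw [← integral_smul, ← integral_congr_ae hκF, Measure.volume_eq_prod,
    ← integral_integral_integral_smul hF ?_ ?_ ?_ ((h.fun_smul _).congr hκF.symm)]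
  · simp only [← integral_smul, smul_smul]
  · simp only [heatKernel, gaussianWeight, Function.uncurry_def]
    fun_prop
  · exact .of_forall fun z => ae_restrict_of_forall_mem measurableSet_Ioi fun b (hb : 0 < b) =>
      mul_nonneg (rpow_nonneg hb.le _) (heatKernel_pos hb _).le
  · exact hne.mono fun z hz => integrableOn_rpow_mul_heatKernel hα hz

theorem IsDistributionalFourier.smul_integral_norm_sub_rpow_smul {u v : E → ℂ} {N : ℕ} {q : ℝ}
    (huv : IsDistributionalFourier N u v) (hq : 1 ≤ q) (hu : MemLp u (.ofReal q)) (ha : 0 < a)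
    (hα : 0 < α) (hα' : α < finrank ℝ E)
    (hspace : Integrable fun z : E × E =>
      ‖z.1 - z.2‖ ^ (α - finrank ℝ E) • (u z.1 * gaussianWeight a z.1 * u z.2))
    (hfreq : Integrable fun z : E × E =>
      ‖z.1‖ ^ (-α) • (v (-z.1) * (v z.2 * heatKernel a (z.2 - z.1)))) :
    (π ^ (-((finrank ℝ E - α) / 2)) * Gamma ((finrank ℝ E - α) / 2)) • ∫ z : E × E,
        ‖z.1 - z.2‖ ^ (α - finrank ℝ E) • (u z.1 * gaussianWeight a z.1 * u z.2) =
      (π ^ (-(α / 2)) * Gamma (α / 2)) • ∫ z : E × E,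
        ‖z.1‖ ^ (-α) • (v (-z.1) * (v z.2 * heatKernel a (z.2 - z.1))) := by
  have hn := hα.trans hα'
  have hv_neg : AEStronglyMeasurable fun η => v (-η) :=
    huv.aestronglyMeasurable.comp_measurePreserving (Measure.measurePreserving_neg volume)
  have hg : Continuous fun x : E => (gaussianWeight a x : ℂ) :=
    Complex.continuous_ofReal.comp continuous_gaussianWeight
  have hh : Continuous fun z : E × E => (heatKernel a (z.2 - z.1) : ℂ) :=
    Complex.continuous_ofReal.comp (continuous_heatKernel.comp (continuous_snd.sub continuous_fst))
  have hspace_meas : AEStronglyMeasurable fun z : E × E => u z.1 * gaussianWeight a z.1 * u z.2 :=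
    (hu.1.mul hg.aestronglyMeasurable).comp_fst.mul hu.1.comp_snd
  have hfreq_meas : AEStronglyMeasurable fun z : E × E =>
      v (-z.1) * (v z.2 * heatKernel a (z.2 - z.1)) :=
    hv_neg.comp_fst.mul (huv.aestronglyMeasurable.comp_snd.mul hh.aestronglyMeasurable)
  rw [← integral_rpow_smul_integral_gaussianWeight_smul hα' hn hspace_meas hspace,
    ← integral_rpow_smul_integral_heatKernel_smul hα hn hfreq_meas hfreq]
  refine setIntegral_congr_fun measurableSet_Ioi fun b (hb : 0 < b) => congr_arg _ ?_
  calc ∫ x, ∫ y, gaussianWeight b (x - y) • (u x * gaussianWeight a x * u y)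
      = ∫ x, u x * gaussianWeight a x * ∫ y, u y * gaussianWeight b (y - x) := by
        simp only [← integral_const_mul]
        refine integral_congr_ae (.of_forall fun x => integral_congr_ae (.of_forall fun y => ?_))
        beta_reduce
        rw [← gaussianWeight_neg, neg_sub, Complex.real_smul]
        ring
    _ = ∫ η, v (-η) * heatKernel b η * ∫ ξ, v ξ * heatKernel a (ξ - η) :=
        huv.integral_gaussianWeight_energy hq hu ha hb
    _ = ∫ η, ∫ ξ, heatKernel b η • (v (-η) * (v ξ * heatKernel a (ξ - η))) := by
        simp only [← integral_const_mul, Complex.real_smul]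
        refine integral_congr_ae (.of_forall fun η => integral_congr_ae (.of_forall fun ξ => ?_))
        ring

theorem IsDistributionalFourier.riesz_smul_integral_norm_sub_rpow_smul {u H : E → ℂ}
    {N : ℕ} {q : ℝ} (huH : IsDistributionalFourier N u fun ξ => H ξ * ((2 * π * ‖ξ‖) ^ s : ℝ))
    (hu : MemLp u (.ofReal q)) (hq : 1 ≤ q) (hH : MemLp H 2) (hs : 0 < s)
    (hsn : 2 * s < finrank ℝ E) (ha : 0 < a)
    (hspace : Integrable fun z : E × E =>
      ‖z.1 - z.2‖ ^ (2 * s - finrank ℝ E) • (u z.1 * gaussianWeight a z.1 * u z.2)) :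
    (Gamma ((finrank ℝ E - 2 * s) / 2) /
        (π ^ ((finrank ℝ E : ℝ) / 2) * 2 ^ (2 * s) * Gamma (2 * s / 2))) • ∫ z : E × E,
        ‖z.1 - z.2‖ ^ (2 * s - finrank ℝ E) • (u z.1 * gaussianWeight a z.1 * u z.2) =
      ∫ z : E × E, (heatKernel a (z.1 - z.2) * (‖z.1‖ ^ s * ‖z.2‖ ^ (-s))) •
        (H z.1 * H (-z.2)) := by
  have hH_neg : MemLp (fun η => H (-η)) 2 :=
    hH.comp_measurePreserving (Measure.measurePreserving_neg volume)
  have hform := (integrable_heatKernel_mul_rpow_smul_mul hs hsn ha hH hH_neg).swap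
  have hswap : ∫ z : E × E, (heatKernel a (z.2 - z.1) * (‖z.2‖ ^ s * ‖z.1‖ ^ (-s))) •
      (H z.2 * H (-z.1)) = ∫ z : E × E, (heatKernel a (z.1 - z.2) * (‖z.1‖ ^ s * ‖z.2‖ ^ (-s))) •
        (H z.1 * H (-z.2)) := integral_prod_swap fun z : E × E =>
    (heatKernel a (z.1 - z.2) * (‖z.1‖ ^ s * ‖z.2‖ ^ (-s))) • (H z.1 * H (-z.2))
  have henergy := huH.smul_integral_norm_sub_rpow_smul hq hu ha (by positivity) hsn hspace
    ((hform.smul ((2 * π) ^ (2 * s))).congr (.of_forall fun z =>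
      (norm_rpow_smul_mul_rpow_norm_mul hs H z.2 z.1).symm))
  simp only [norm_rpow_smul_mul_rpow_norm_mul hs H] at henergy
  rw [integral_smul, smul_smul, hswap] at henergy
  have hΓ := Gamma_pos_of_pos (show 0 < 2 * s / 2 by linarith)
  have hconst : Gamma ((finrank ℝ E - 2 * s) / 2) /
      (π ^ ((finrank ℝ E : ℝ) / 2) * 2 ^ (2 * s) * Gamma (2 * s / 2)) =
        (π ^ (-(2 * s / 2)) * Gamma (2 * s / 2) * (2 * π) ^ (2 * s))⁻¹ *
        (π ^ (-((finrank ℝ E - 2 * s) / 2)) * Gamma ((finrank ℝ E - 2 * s) / 2)) := by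
    rw [mul_rpow two_pos.le pi_pos.le, show -((finrank ℝ E - 2 * s) / 2) =
      -((finrank ℝ E : ℝ) / 2) + s by ring, rpow_add pi_pos, rpow_neg pi_pos.le,
      show 2 * s / 2 = s by ring, rpow_neg pi_pos.le, two_mul s, rpow_add pi_pos]
    field_simp
  rw [hconst, mul_smul, inv_smul_eq_iff₀ (by positivity)]
  exact henergy

end RieszEnergy

section Cutoff

variable {X : Type*} [MeasurableSpace X] {μ : Measure X}

theorem integrable_of_tendsto_integral_norm {F : ℕ → X → ℝ} {g : X → ℝ} {L : ℝ}
    (hF : ∀ k, Integrable (F k) μ) (hFg : ∀ᵐ x ∂μ, Tendsto (fun k => F k x) atTop (𝓝 (g x)))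
    (hL : Tendsto (fun k => ∫ x, ‖F k x‖ ∂μ) atTop (𝓝 L)) : Integrable g μ := by
  refine memLp_one_iff_integrable.mp ⟨aestronglyMeasurable_of_tendsto_ae _ (fun k => (hF k).1) hFg,
    (Lp.eLpNorm_lim_le_liminf_eLpNorm (fun k => (hF k).1) g hFg).trans_lt ?_⟩
  simp only [eLpNorm_one_eq_lintegral_enorm, ← ofReal_integral_norm_eq_lintegral_enorm (hF _)]
  rw [(ENNReal.tendsto_ofReal hL).liminf_eq]
  exact ENNReal.ofReal_lt_top

variable {χ : ℕ → X → ℝ}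

theorem tendsto_integral_cutoff_mul (hχm : ∀ k, AEStronglyMeasurable (χ k) μ)
    (hχ₀ : ∀ k x, 0 ≤ χ k x) (hχ₁ : ∀ k x, χ k x ≤ 1)
    (hχ : ∀ x, Tendsto (fun k => χ k x) atTop (𝓝 1)) {g : X → ℝ} (hg : Integrable g μ) :
    Tendsto (fun k => ∫ x, χ k x * g x ∂μ) atTop (𝓝 (∫ x, g x ∂μ)) := by
  refine tendsto_integral_of_dominated_convergence (fun x => ‖g x‖) (fun k => (hχm k).mul hg.1)
    hg.norm (fun k => .of_forall fun x => ?_) (.of_forall fun x => ?_)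
  · rw [norm_mul, norm_of_nonneg (hχ₀ k x)]
    exact mul_le_of_le_one_left (norm_nonneg _) (hχ₁ k x)
  · simpa using (hχ x).mul_const (g x)

theorem integrable_and_integral_eq_of_tendsto_cutoff (hχm : ∀ k, AEStronglyMeasurable (χ k) μ)
    (hχ₀ : ∀ k x, 0 ≤ χ k x) (hχ₁ : ∀ k x, χ k x ≤ 1)
    (hχ : ∀ x, Tendsto (fun k => χ k x) atTop (𝓝 1)) {g f : X → ℝ} (hf : Integrable f μ)
    (hfg : ∀ᵐ x ∂μ, -|f x| ≤ g x) (hint : ∀ k, Integrable (fun x => χ k x * g x) μ) {L : ℝ}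
    (hL : Tendsto (fun k => ∫ x, χ k x * g x ∂μ) atTop (𝓝 L)) :
    Integrable g μ ∧ ∫ x, g x ∂μ = L := by
  have hχf : ∀ k, Integrable (fun x => χ k x * |f x|) μ := fun k =>
    hf.abs.bdd_mul (c := 1) (hχm k) (.of_forall fun x => by
      rw [norm_of_nonneg (hχ₀ k x)]
      exact hχ₁ k x)
  have hnorm : ∀ k, ∫ x, ‖χ k x * (g x + |f x|)‖ ∂μ =
      ∫ x, χ k x * g x ∂μ + ∫ x, χ k x * |f x| ∂μ := fun k => by
    rw [← integral_add (hint k) (hχf k)]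
    refine integral_congr_ae (hfg.mono fun x hx => ?_)
    beta_reduce
    rw [norm_of_nonneg (mul_nonneg (hχ₀ k x) (by linarith)), mul_add]
  have hsum : Integrable (fun x => g x + |f x|) μ := by
    refine integrable_of_tendsto_integral_norm (L := L + ∫ x, |f x| ∂μ)
      (F := fun k x => χ k x * (g x + |f x|))
      (fun k => ((hint k).add (hχf k)).congr (.of_forall fun x => (mul_add _ _ _).symm))
      (.of_forall fun x => by simpa using (hχ x).mul_const (g x + |f x|)) ?_
    simp only [hnorm]
    exact hL.add (tendsto_integral_cutoff_mul hχm hχ₀ hχ₁ hχ hf.abs)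
  have hg : Integrable g μ := (hsum.sub hf.abs).congr (.of_forall fun x => add_sub_cancel_right _ _)
  exact ⟨hg, tendsto_nhds_unique (tendsto_integral_cutoff_mul hχm hχ₀ hχ₁ hχ hg) hL⟩

end Cutoff

section RieszPotential

variable {d : ℕ} {α s q a : ℝ} {τ : EuclideanSpace ℝ (Fin d) → ℝ}

theorem rieszPotential_eq (α : ℝ) (τ : EuclideanSpace ℝ (Fin d) → ℝ)
    (x : EuclideanSpace ℝ (Fin d)) :
    rieszPotential α τ x =
      Gamma ((d - α) / 2) / (π ^ ((d : ℝ) / 2) * 2 ^ α * Gamma (α / 2)) *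
        ∫ y, ‖x - y‖ ^ (α - d) * τ y := by
  rw [rieszPotential, convolution_def, ← integral_const_mul, ← integral_sub_left_eq_self _ volume x]
  simp only [ContinuousLinearMap.mul_apply', rieszKernel, sub_sub_cancel, mul_assoc]

theorem convolutionExistsAt_rieszKernel {x : EuclideanSpace ℝ (Fin d)}
    (h : Integrable fun y => ‖x - y‖ ^ (α - d) * τ y) :
    ConvolutionExistsAt (rieszKernel d α) τ x (ContinuousLinearMap.mul ℝ ℝ) volume :=
  ((h.comp_sub_left x).const_mul
    (Gamma ((d - α) / 2) / (π ^ ((d : ℝ) / 2) * 2 ^ α * Gamma (α / 2)))).congr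
    (.of_forall fun y => by
      simp only [ContinuousLinearMap.mul_apply', rieszKernel, sub_sub_cancel, mul_assoc])

theorem one_lt_of_two_mul_div_add_lt {n : ℝ} (hα : 0 < α) (hα' : α < n)
    (hq : 2 * n / (n + α) < q) : 1 < q :=
  hq.trans_le' ((one_le_div (by linarith)).mpr (by linarith))

theorem norm_gaussianWeight_le_one (ha : 0 < a) (x : EuclideanSpace ℝ (Fin d)) :
    ‖gaussianWeight a x‖ ≤ 1 := by
  rw [norm_of_nonneg (gaussianWeight_pos a x).le]
  exact gaussianWeight_le_one ha.le x

theorem ae_convolutionExistsAt_rieszKernel (hα : 0 < α) (hα' : α < d)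
    (hq : 2 * (d : ℝ) / (d + α) < q) (hq' : q < (d : ℝ) / α) (hτ : MemLp τ (.ofReal q)) :
    ∀ᵐ x, ConvolutionExistsAt (rieszKernel d α) τ x (ContinuousLinearMap.mul ℝ ℝ) volume := by
  have hg : Integrable (gaussianWeight (E := EuclideanSpace ℝ (Fin d)) 1) :=
    integrable_gaussianWeight one_pos
  have h := integrable_mul_norm_sub_rpow_mul (E := EuclideanSpace ℝ (Fin d)) (μ := volume)
    hα (by simpa) (by simpa) (by simpa) hg (memLp_of_integrable_of_norm_le_one
      (one_lt_of_two_mul_div_add_lt hα hα' hq).le hg (norm_gaussianWeight_le_one one_pos)) hτ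
  simp only [finrank_euclideanSpace_fin, mul_assoc] at h
  filter_upwards [h.prod_right_ae] with x hx
  refine convolutionExistsAt_rieszKernel ((hx.const_mul (gaussianWeight 1 x)⁻¹).congr
    (.of_forall fun y => ?_))
  exact inv_mul_cancel_left₀ (gaussianWeight_pos 1 x).ne' _

theorem integrable_norm_sub_rpow_mul_gaussianWeight (hα : 0 < α) (hα' : α < d)
    (hq : 2 * (d : ℝ) / (d + α) < q) (hq' : q < (d : ℝ) / α) (hτ : MemLp τ (.ofReal q))
    (ha : 0 < a) :
    Integrable fun z : EuclideanSpace ℝ (Fin d) × EuclideanSpace ℝ (Fin d) =>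
      ‖z.1 - z.2‖ ^ (α - d) * (τ z.1 * gaussianWeight a z.1 * τ z.2) := by
  have hτg : Integrable fun x => gaussianWeight a x * τ x :=
    integrable_mul_of_norm_le_one (one_lt_of_two_mul_div_add_lt hα hα' hq).le hτ
      (integrable_gaussianWeight ha) (norm_gaussianWeight_le_one ha)
  have hτg' : MemLp (fun x => gaussianWeight a x * τ x) (.ofReal q) :=
    hτ.mono hτg.1 (.of_forall fun x => by
      rw [norm_mul]
      exact mul_le_of_le_one_left (norm_nonneg _) (norm_gaussianWeight_le_one ha x))
  have h := integrable_mul_norm_sub_rpow_mul (E := EuclideanSpace ℝ (Fin d)) (μ := volume)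
    hα (by simpa) (by simpa) (by simpa) hτg hτg' hτ
  rw [finrank_euclideanSpace_fin] at h
  exact h.congr (.of_forall fun z => by ring)

theorem integral_norm_sub_rpow_mul_gaussianWeight (x : EuclideanSpace ℝ (Fin d)) :
    ∫ y, Gamma ((d - α) / 2) / (π ^ ((d : ℝ) / 2) * 2 ^ α * Gamma (α / 2)) *
      (‖x - y‖ ^ (α - d) * (τ x * gaussianWeight a x * τ y)) =
        gaussianWeight a x * (τ x * rieszPotential α τ x) := by
  rw [rieszPotential_eq, integral_const_mul]
  simp only [mul_left_comm (‖x - _‖ ^ (α - d)), integral_const_mul]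
  ring

theorem integrable_gaussianWeight_mul_rieszPotential
    (h : Integrable fun z : EuclideanSpace ℝ (Fin d) × EuclideanSpace ℝ (Fin d) =>
      ‖z.1 - z.2‖ ^ (α - d) * (τ z.1 * gaussianWeight a z.1 * τ z.2)) :
    Integrable fun x => gaussianWeight a x * (τ x * rieszPotential α τ x) :=
  (h.const_mul (Gamma ((d - α) / 2) / (π ^ ((d : ℝ) / 2) * 2 ^ α * Gamma (α / 2)))
    ).integral_prod_left.congr (.of_forall integral_norm_sub_rpow_mul_gaussianWeight)

theorem integral_gaussianWeight_mul_rieszPotential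
    (h : Integrable fun z : EuclideanSpace ℝ (Fin d) × EuclideanSpace ℝ (Fin d) =>
      ‖z.1 - z.2‖ ^ (α - d) * (τ z.1 * gaussianWeight a z.1 * τ z.2)) :
    ∫ x, gaussianWeight a x * (τ x * rieszPotential α τ x) =
      Gamma ((d - α) / 2) / (π ^ ((d : ℝ) / 2) * 2 ^ α * Gamma (α / 2)) *
        ∫ z : EuclideanSpace ℝ (Fin d) × EuclideanSpace ℝ (Fin d),
          ‖z.1 - z.2‖ ^ (α - d) * (τ z.1 * gaussianWeight a z.1 * τ z.2) := by
  rw [← integral_const_mul, Measure.volume_eq_prod, integral_prod _ (h.const_mul _)]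
  simp only [integral_norm_sub_rpow_mul_gaussianWeight]

theorem HomSobolev.IsRegularDistribution.exists_integral_gaussianWeight_eq_heatForm
    {T : StrongDual ℝ (HomSobolev d s)} (hT : HomSobolev.IsRegularDistribution T τ) (hs : 0 < s)
    (hsd : 2 * s < d) (hq : 2 * (d : ℝ) / (d + 2 * s) < q) (hq' : q < (d : ℝ) / (2 * s))
    (hτ : MemLp τ (.ofReal q)) :
    ∃ H : EuclideanSpace ℝ (Fin d) → ℂ, MemLp H 2 ∧ (∀ᵐ ξ, H (-ξ) = conj (H ξ)) ∧
      ∫ ξ, ‖H ξ‖ ^ 2 = ‖T‖ ^ 2 ∧ ∀ a, 0 < a →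
        ((∫ x, gaussianWeight a x * (τ x * rieszPotential (2 * s) τ x) : ℝ) : ℂ) =
          ∫ z : EuclideanSpace ℝ (Fin d) × EuclideanSpace ℝ (Fin d),
            (heatKernel a (z.1 - z.2) * (‖z.1‖ ^ s * ‖z.2‖ ^ (-s))) • (H z.1 * H (-z.2)) := by
  have hq₁ : 1 ≤ q := (one_lt_of_two_mul_div_add_lt (by positivity) hsd hq).le
  obtain ⟨H, hH, hH_conj, hH_norm, hτH⟩ :=
    hT.exists_fourier_density hs.le (hτ.locallyIntegrable (ENNReal.one_le_ofReal.mpr hq₁))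
  obtain ⟨N, hN⟩ := exists_nat_gt (s + finrank ℝ (EuclideanSpace ℝ (Fin d)) / 2)
  have hFourier : IsDistributionalFourier N (fun x => (τ x : ℂ))
      fun ξ => H ξ * ((2 * π * ‖ξ‖) ^ s : ℝ) :=
    { aestronglyMeasurable := hH.1.mul (Continuous.aestronglyMeasurable <|
        Complex.continuous_ofReal.comp <|
          (continuous_const.mul continuous_norm).rpow_const fun _ => .inr hs.le)
      integrable :=
        integrable_norm_mul_rpow_mul_one_add_norm_pow_inv hH two_pi_pos.le hs.le hN
      integral_eq := hτH }
  refine ⟨H, hH, hH_conj, hH_norm, fun a ha => ?_⟩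
  have hspace := integrable_norm_sub_rpow_mul_gaussianWeight (by positivity) hsd hq hq' hτ ha
  have hcast : ∀ z : EuclideanSpace ℝ (Fin d) × EuclideanSpace ℝ (Fin d),
      ((‖z.1 - z.2‖ ^ (2 * s - d) * (τ z.1 * gaussianWeight a z.1 * τ z.2) : ℝ) : ℂ) =
        ‖z.1 - z.2‖ ^ (2 * s - d) • ((τ z.1 : ℂ) * gaussianWeight a z.1 * τ z.2) := fun z => by
    rw [Complex.real_smul]
    push_cast
    rfl
  have hriesz := hFourier.riesz_smul_integral_norm_sub_rpow_smul hτ.ofReal hq₁ hH hs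
    (by simpa) ha (by
      rw [finrank_euclideanSpace_fin]
      exact hspace.ofReal.congr (.of_forall hcast))
  simp only [finrank_euclideanSpace_fin, ← hcast, integral_complex_ofReal] at hriesz
  rw [integral_gaussianWeight_mul_rieszPotential hspace, ← hriesz, Complex.real_smul,
    Complex.ofReal_mul]

theorem HomSobolev.IsRegularDistribution.tendsto_integral_gaussianWeight_mul_rieszPotential
    {T : StrongDual ℝ (HomSobolev d s)} (hT : HomSobolev.IsRegularDistribution T τ) (hs : 0 < s)
    (hsd : 2 * s < d) (hq : 2 * (d : ℝ) / (d + 2 * s) < q) (hq' : q < (d : ℝ) / (2 * s))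
    (hτ : MemLp τ (.ofReal q)) :
    Tendsto (fun a => ∫ x, gaussianWeight a x * (τ x * rieszPotential (2 * s) τ x)) (𝓝[>] 0)
      (𝓝 (‖T‖ ^ 2)) := by
  obtain ⟨H, hH, hH_conj, hH_norm, hform⟩ :=
    hT.exists_integral_gaussianWeight_eq_heatForm hs hsd hq hq' hτ
  have hlim : ∫ ξ, H ξ * H (-ξ) = ((‖T‖ ^ 2 : ℝ) : ℂ) := by
    rw [← hH_norm, ← integral_complex_ofReal]
    refine integral_congr_ae (hH_conj.mono fun ξ hξ => ?_)
    beta_reduce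
    rw [hξ, Complex.mul_conj', Complex.ofReal_pow]
  have hheat := tendsto_integral_heatKernel_mul_rpow_smul_mul hs (by simpa) hH
    (hH.comp_measurePreserving (Measure.measurePreserving_neg volume))
  rw [← tendsto_ofReal_iff, ← hlim]
  exact hheat.congr' (eventually_mem_nhdsWithin.mono fun a ha => (hform a ha).symm)

end RieszPotential

theorem corollary5p6_general (d : ℕ) (s : ℝ) (hs : 0 < s) (hsd : s < (d : ℝ) / 2)
    (q : ℝ) (hq : 2 * (d : ℝ) / (d + 2 * s) < q) (hq' : q < (d : ℝ) / (2 * s))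
    (τ : EuclideanSpace ℝ (Fin d) → ℝ) (hτ : MemLp τ (ENNReal.ofReal q) volume)
    (T : StrongDual ℝ (HomSobolev d s)) (hT : HomSobolev.IsRegularDistribution T τ)
    (f : EuclideanSpace ℝ (Fin d) → ℝ) (hf : Integrable f volume)
    (hTf : ∀ᵐ x, -|f x| ≤ τ x * rieszPotential (2 * s) τ x) :
    (∀ᵐ x, ConvolutionExistsAt (rieszKernel d (2 * s)) τ x (ContinuousLinearMap.mul ℝ ℝ) volume) ∧
      Integrable (fun x => rieszPotential (2 * s) τ x * τ x) volume ∧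
      ‖T‖ ^ 2 = coulombEnergy (2 * s) τ := by
  have hα : 0 < 2 * s := by positivity
  have hα' : 2 * s < d := by linarith
  have hε : ∀ k : ℕ, 0 < 1 / ((k : ℝ) + 1) := fun _ => Nat.one_div_pos_of_nat
  have hε₀ := tendsto_one_div_add_atTop_nhds_zero_nat (𝕜 := ℝ)
  obtain ⟨hint, henergy⟩ := integrable_and_integral_eq_of_tendsto_cutoff
    (χ := fun k => gaussianWeight (1 / ((k : ℝ) + 1)))
    (fun k => continuous_gaussianWeight.aestronglyMeasurable)
    (fun k x => (gaussianWeight_pos _ x).le)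
    (fun k => gaussianWeight_le_one (hε k).le) (fun x => (tendsto_gaussianWeight_zero x).comp hε₀)
    hf hTf (fun k => integrable_gaussianWeight_mul_rieszPotential
      (integrable_norm_sub_rpow_mul_gaussianWeight hα hα' hq hq' hτ (hε k)))
    ((hT.tendsto_integral_gaussianWeight_mul_rieszPotential hs hα' hq hq' hτ).comp
      (tendsto_nhdsWithin_iff.mpr ⟨hε₀, .of_forall hε⟩))
  simp only [mul_comm (τ _)] at hint henergy
  exact ⟨ae_convolutionExistsAt_rieszKernel hα hα' hq hq' hτ, hint, henergy.symm⟩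

theorem corollary5p6 (d : ℕ) (hd : 2 ≤ d) (s : ℝ) (hs : 0 < s) (hsd : s < (d : ℝ) / 2)
    (q : ℝ) (hq : 2 * (d : ℝ) / (d + 2 * s) < q) (hq' : q < (d : ℝ) / (2 * s))
    (τ : EuclideanSpace ℝ (Fin d) → ℝ) (hτ : MemLp τ (ENNReal.ofReal q) volume)
    (T : StrongDual ℝ (HomSobolev d s)) (hT : HomSobolev.IsRegularDistribution T τ)
    (f : EuclideanSpace ℝ (Fin d) → ℝ) (hf : Integrable f volume)
    (hTf : ∀ᵐ x, -|f x| ≤ τ x * rieszPotential (2 * s) τ x) :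
    (∀ᵐ x, ConvolutionExistsAt (rieszKernel d (2 * s)) τ x (ContinuousLinearMap.mul ℝ ℝ) volume) ∧
      Integrable (fun x => rieszPotential (2 * s) τ x * τ x) volume ∧
      ‖T‖ ^ 2 = coulombEnergy (2 * s) τ :=
  corollary5p6_general d s hs hsd q hq hq' τ hτ T hT f hf hTf
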